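/- **Setting.** Let $\ell\ge 2$, $d\ge 1$. At each time $j=1,2,\dots$ a covariate $X_j\in[0,1]^d$ is seen, an arm $I_j\in\{1,\dots,\ell\}$ is pulled, and the reward $Y_{i,j}=f_i(X_j)+\varepsilon_{i,j}$ of the arm $i=I_j$ is observed at time $t_j=j+d_j$, with a delay $d_j\in[0,\infty]$ with distribution function $G_j(s)=P(d_j\le s)$. The $X_j$ are i.i.d. with law $P_X$; the delays are mutually independent (not necessarily identically distributed) and independent of the covariates; the errors have mean zero, and for each $j$ the error vector $(\varepsilon_{i,j})_{i}$ is independent of all covariates, all delays, the earlier error vectors and $I_1,\dots,I_j$. **Estimators.** Let $h_n$ be bandwidths with $1/h_n$ a positive integer and $h_n\to0$. For the partition of $[0,1]^d$ into $h_n^{-d}$ cubes of side $h_n$, the histogram estimator $\hat f^{\,\mathrm{hist}}_{i,n}(x)$ is the average of the $Y_{i,j}$ over all $j$ with $I_j=i$, $t_j\le n$ and $X_j$ in the cube of $x$ ($0$ if there is no such $j$). **Allocation rule $\delta_\pi$.** Let $(\pi_n)_{n\ge1}$ be positive numbers in $[0,1]$ decreasing to zero. Up to the first time $m_0$ at which at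 least one reward of every arm has been observed, arms are pulled according to a prescribed schedule that starts with $1,2,\dots,\ell$ (for instance cyclically); assume $m_0<\infty$ almost surely. At $n=m_0$ put $\hat f_{i,n}=\hat f^{\,\mathrm{hist}}_{i,n}$. For $n\ge m_0$ let $\hat i_{n+1}$ be a maximizer of $i\mapsto\hat f_{i,n}(X_{n+1})$ (ties are broken by a fixed measurable rule applied to the vector of estimates); conditionally on all covariates, all delays and the errors and arms up to time $n$, the arm $I_{n+1}$ equals $\hat i_{n+1}$ with probability $1-(\ell-1)\pi_{n+1}$ and each other arm with probability $\pi_{n+1}$. Then $\hat f_{i,n+1}=\hat f^{\,\mathrm{hist}}_{i,n+1}$ if some reward of arm $i$ is obtained in the time interval $(n,n+1]$, and $\hat f_{i,n+1}=\hat f_{i,n}$ otherwise. (For $n<m_0$ put $\hat f_{i,n}=\hat f^{\,\mathrm{hist}}_{i,n}$.) **Theorem.** Let $f^*=\max_i f_i$ and assume: 1. every $f_i$ is continuous and nonnegative on $[0,1]^d$, $\sup_i\sup_x (f^*(x)-f_i(x))<\infty$ and $E f^*(X_1)>0$; 2. $P_X$ has a density $p$ with respect to Lebesgue measure on $[0,1]^d$,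 with $\underline c\le p\le\bar c$ there for some positive constants $\underline c,\bar c$; 3. there are $v,c>0$ with $E|\varepsilon_{i,j}|^m\le\frac{m!}{2}v^2c^{m-2}$ for all $m\ge2$ and all $i,j$; 4. $\sum_{j=1}^n G_j(n-j)=\Omega(n^\alpha(\log n)^\beta)$, that is, for some $c'>0$ it is at least $c' n^\alpha(\log n)^\beta$ for all large $n$, where either $\alpha>0$ and $\beta\in\mathbb R$, or $\alpha=0$ and $\beta>1$; 5. $n^\alpha(\log n)^{\beta-1}h_n^d\pi_n^2\to\infty$ with the same $\alpha,\beta$. Then, almost surely, for every arm $i$ both $\sup_{x\in[0,1]^d}|\hat f^{\,\mathrm{hist}}_{i,n}(x)-f_i(x)|\to0$ and $\sup_{x\in[0,1]^d}|\hat f_{i,n}(x)-f_i(x)|\to0$ as $n\to\infty$, and the allocation rule is strongly consistent: $$R_n(\delta_\pi)=\frac{\sum_{j=1}^n f_{I_j}(X_j)}{\sum_{j=1}^n f^*(X_j)}\longrightarrow 1\quad\text{almost surely.}$$ -/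

import Mathlib

open MeasureTheory ProbabilityTheory Filter Topology
open scoped ENNReal

namespace DelayedBandit

/-- The unit cube `[0,1]^d`. -/
def unitCube (d : ℕ) : Set (Fin d → ℝ) := Set.Icc 0 1

/-- The pointwise best mean reward `f*(x) = max_i f_i(x)`. -/
noncomputable def fStar {ℓ d : ℕ} (f : Fin ℓ → (Fin d → ℝ) → ℝ) (x : Fin d → ℝ) : ℝ :=
  ⨆ i, f i x

section

/-!
Times are natural numbers `j ≥ 1`; the value of a process at index `0` is never used.
`X j` is the covariate, `ε j ω i` the error of arm `i`, `D j` the (possibly infinite) delay and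
`I j` the selected arm at time `j`.
-/

variable {Ω : Type*} {ℓ d : ℕ}

/-- The time `t_j = j + d_j` at which the reward of the `j`-th pull is observed. -/
noncomputable def obsTime (D : ℕ → Ω → ℝ≥0∞) (j : ℕ) (ω : Ω) : ℝ≥0∞ := (j : ℝ≥0∞) + D j ω

/-- The reward `Y_{i,j} = f_i(X_j) + ε_{i,j}` of arm `i` at time `j`. -/
def reward (f : Fin ℓ → (Fin d → ℝ) → ℝ) (X : ℕ → Ω → Fin d → ℝ) (ε : ℕ → Ω → Fin ℓ → ℝ)
    (i : Fin ℓ) (j : ℕ) (ω : Ω) : ℝ :=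
  f i (X j ω) + ε j ω i

/-- The label of the cube of side `h` (with `1/h` an integer) containing `x ∈ [0,1]^d`. In each
coordinate the cells are `[0,h), [h,2h), …, [1-h,1]`. -/
noncomputable def cellIndex (h : ℝ) (x : Fin d → ℝ) : Fin d → ℕ :=
  fun k => min ⌊x k / h⌋₊ (⌊1 / h⌋₊ - 1)

open Classical in
/-- The times `j ≤ n` at which arm `i` was pulled with a covariate in the same cube as `x` (for the
bandwidth `h`), and whose reward is observed by time `n`. -/
noncomputable def armTimes (h : ℝ) (X : ℕ → Ω → Fin d → ℝ) (D : ℕ → Ω → ℝ≥0∞) (I : ℕ → Ω → Fin ℓ)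
    (i : Fin ℓ) (n : ℕ) (ω : Ω) (x : Fin d → ℝ) : Finset ℕ :=
  (Finset.Icc 1 n).filter fun j =>
    I j ω = i ∧ cellIndex h (X j ω) = cellIndex h x ∧ obsTime D j ω ≤ (n : ℝ≥0∞)

/-- The histogram estimator of `f_i` at time `n` with bandwidth `h n`: the average of the observed
rewards of arm `i` in the cube of `x` (and `0` if there is none). -/
noncomputable def histEst (f : Fin ℓ → (Fin d → ℝ) → ℝ) (h : ℕ → ℝ) (X : ℕ → Ω → Fin d → ℝ)
    (ε : ℕ → Ω → Fin ℓ → ℝ) (D : ℕ → Ω → ℝ≥0∞) (I : ℕ → Ω → Fin ℓ)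
    (i : Fin ℓ) (n : ℕ) (ω : Ω) (x : Fin d → ℝ) : ℝ :=
  (∑ j ∈ armTimes (h n) X D I i n ω x, reward f X ε i j ω) /
    ((armTimes (h n) X D I i n ω x).card : ℝ)

/-- By time `n` at least one reward of every arm has been observed. The first such `n` is the
(random) end `m₀` of the initialization. -/
def InitDone (D : ℕ → Ω → ℝ≥0∞) (I : ℕ → Ω → Fin ℓ) (n : ℕ) (ω : Ω) : Prop :=
  ∀ i : Fin ℓ, ∃ j ∈ Finset.Icc 1 n, I j ω = i ∧ obsTime D j ω ≤ (n : ℝ≥0∞)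

/-- A reward of arm `i` arrives at time `n + 1`, that is, in the time interval `(n, n + 1]`. -/
def NewReward (D : ℕ → Ω → ℝ≥0∞) (I : ℕ → Ω → Fin ℓ) (i : Fin ℓ) (n : ℕ) (ω : Ω) : Prop :=
  ∃ j ∈ Finset.Icc 1 (n + 1), I j ω = i ∧ (n : ℝ≥0∞) < obsTime D j ω ∧
    obsTime D j ω ≤ ((n + 1 : ℕ) : ℝ≥0∞)

open Classical in
/-- The estimator of `f_i` that the allocation rule holds after time `n`: the histogram estimator up
to the end of the initialization; afterwards it is recomputed exactly at the times at which a reward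
of arm `i` arrives, and is kept unchanged otherwise. -/
noncomputable def ruleEst (f : Fin ℓ → (Fin d → ℝ) → ℝ) (h : ℕ → ℝ) (X : ℕ → Ω → Fin d → ℝ)
    (ε : ℕ → Ω → Fin ℓ → ℝ) (D : ℕ → Ω → ℝ≥0∞) (I : ℕ → Ω → Fin ℓ)
    (i : Fin ℓ) : ℕ → Ω → (Fin d → ℝ) → ℝ
  | 0, ω, x => histEst f h X ε D I i 0 ω x
  | n + 1, ω, x =>
    if InitDone D I n ω ∧ ¬ NewReward D I i n ω then ruleEst f h X ε D I i n ω x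
    else histEst f h X ε D I i (n + 1) ω x

/-- The ratio `R_n` of the total mean reward of the selected arms to the optimal one. -/
noncomputable def rewardRatio (f : Fin ℓ → (Fin d → ℝ) → ℝ) (X : ℕ → Ω → Fin d → ℝ)
    (I : ℕ → Ω → Fin ℓ) (n : ℕ) (ω : Ω) : ℝ :=
  (∑ j ∈ Finset.Icc 1 n, f (I j ω) (X j ω)) / (∑ j ∈ Finset.Icc 1 n, fStar f (X j ω))

/-- The σ-algebra generated by all covariates, all delays, and the errors and selected arms at the
times `1, …, j - 1`. -/
@[reducible]
def history (X : ℕ → Ω → Fin d → ℝ) (ε : ℕ → Ω → Fin ℓ → ℝ) (D : ℕ → Ω → ℝ≥0∞)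
    (I : ℕ → Ω → Fin ℓ) (j : ℕ) : MeasurableSpace Ω :=
  (⨆ k ∈ Set.Ici 1, MeasurableSpace.comap (X k) inferInstance) ⊔
  (⨆ k ∈ Set.Ici 1, MeasurableSpace.comap (D k) inferInstance) ⊔
  (⨆ k ∈ Set.Ico 1 j, MeasurableSpace.comap (ε k) inferInstance) ⊔
  (⨆ k ∈ Set.Ico 1 j, MeasurableSpace.comap (I k) inferInstance)

variable [MeasurableSpace Ω]

/-- The allocation rule is strongly consistent: `R_n → 1` almost surely. -/
def StronglyConsistent (μ : Measure Ω) (f : Fin ℓ → (Fin d → ℝ) → ℝ) (X : ℕ → Ω → Fin d → ℝ)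
    (I : ℕ → Ω → Fin ℓ) : Prop :=
  ∀ᵐ ω ∂μ, Tendsto (fun n => rewardRatio f X I n ω) atTop (𝓝 1)

/-- The bandit model with delays: i.i.d. covariates in the cube with law `PX`, mutually independent
delays that are independent of the covariates, and centred errors; the error at time `j` is
independent of the covariates, the delays, the earlier errors and the arms selected up to time `j`
(so in particular the errors at different times are independent). -/
structure IsModel (μ : Measure Ω) (PX : Measure (Fin d → ℝ)) (X : ℕ → Ω → Fin d → ℝ)
    (ε : ℕ → Ω → Fin ℓ → ℝ) (D : ℕ → Ω → ℝ≥0∞) (I : ℕ → Ω → Fin ℓ) : Prop where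
  measurable_covariate : ∀ j, 1 ≤ j → Measurable (X j)
  measurable_error : ∀ j, 1 ≤ j → Measurable (ε j)
  measurable_delay : ∀ j, 1 ≤ j → Measurable (D j)
  measurable_arm : ∀ j, 1 ≤ j → Measurable (I j)
  covariate_mem : ∀ j, 1 ≤ j → ∀ ω, X j ω ∈ unitCube d
  covariate_law : ∀ j, 1 ≤ j → μ.map (X j) = PX
  covariate_indep : iIndepFun (fun j : ℕ => X (j + 1)) μ
  delay_indep : iIndepFun (fun j : ℕ => D (j + 1)) μ
  covariate_delay_indep :
    IndepFun (fun ω (j : ℕ) => X (j + 1) ω) (fun ω (j : ℕ) => D (j + 1) ω) μ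
  error_mean : ∀ j, 1 ≤ j → ∀ i, Integrable (fun ω => ε j ω i) μ ∧ ∫ ω, ε j ω i ∂μ = 0
  error_indep : ∀ j, 1 ≤ j →
    Indep (MeasurableSpace.comap (ε j) inferInstance)
      (history X ε D I j ⊔ MeasurableSpace.comap (I j) inferInstance) μ

/-- The arms `I` are selected by the allocation rule `δ_π` with histogram estimators of bandwidth
`h`. Here `a` is the schedule of forced allocations, starting with each arm once, and `sel` chooses
a maximizer of a finite family of numbers (it breaks ties). As long as the initialization is not
finished, arms are pulled according to `a`. Afterwards, conditionally on the history (all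
randomization is fresh), the arm that maximizes the current estimates at the current covariate is
pulled with probability `1 - (ℓ - 1) π`, and each other arm with probability `π`. -/
structure FollowsRule (μ : Measure Ω) (f : Fin ℓ → (Fin d → ℝ) → ℝ) (h prob : ℕ → ℝ)
    (a : ℕ → Fin ℓ) (sel : (Fin ℓ → ℝ) → Fin ℓ) (X : ℕ → Ω → Fin d → ℝ)
    (ε : ℕ → Ω → Fin ℓ → ℝ) (D : ℕ → Ω → ℝ≥0∞) (I : ℕ → Ω → Fin ℓ) : Prop where
  schedule_start : ∀ i : Fin ℓ, a ((i : ℕ) + 1) = i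
  sel_measurable : Measurable sel
  sel_max : ∀ (v : Fin ℓ → ℝ) (i : Fin ℓ), v i ≤ v (sel v)
  forced : ∀ n : ℕ, ∀ᵐ ω ∂μ, ¬ InitDone D I n ω → I (n + 1) ω = a (n + 1)
  randomized : ∀ (n : ℕ) (i : Fin ℓ), ∀ᵐ ω ∂μ, InitDone D I n ω →
    (μ[Set.indicator {ω' | I (n + 1) ω' = i} (fun _ => (1 : ℝ)) | history X ε D I (n + 1)]) ω =
      if i = sel (fun k => ruleEst f h X ε D I k n ω (X (n + 1) ω))
      then 1 - ((ℓ : ℝ) - 1) * prob (n + 1) else prob (n + 1)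

/-- The mean reward functions are continuous and nonnegative on the cube, with bounded gaps
`f* - f_i`, and `E f*(X_1) > 0`. -/
structure MeanRewardCondition (μ : Measure Ω) (f : Fin ℓ → (Fin d → ℝ) → ℝ)
    (X : ℕ → Ω → Fin d → ℝ) : Prop where
  continuousOn : ∀ i, ContinuousOn (f i) (unitCube d)
  nonneg : ∀ i, ∀ x ∈ unitCube d, 0 ≤ f i x
  gap_bounded : ∃ A : ℝ, ∀ i, ∀ x ∈ unitCube d, fStar f x - f i x ≤ A
  mean_pos : 0 < ∫ ω, fStar f (X 1 ω) ∂μ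

/-- The design distribution has a density on the cube, bounded above and away from zero. -/
def DesignCondition (PX : Measure (Fin d → ℝ)) : Prop :=
  ∃ (p : (Fin d → ℝ) → ℝ) (cLow cUp : ℝ), Measurable p ∧ 0 < cLow ∧
    (∀ x ∈ unitCube d, cLow ≤ p x ∧ p x ≤ cUp) ∧
    PX = (volume.restrict (unitCube d)).withDensity (fun x => ENNReal.ofReal (p x))

/-- Bernstein's moment condition on the errors, with constants common to all arms and times. -/
def BernsteinCondition (μ : Measure Ω) (ε : ℕ → Ω → Fin ℓ → ℝ) : Prop :=
  ∃ v c : ℝ, 0 < v ∧ 0 < c ∧ ∀ j, 1 ≤ j → ∀ i, ∀ m : ℕ, 2 ≤ m →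
    Integrable (fun ω => |ε j ω i| ^ m) μ ∧
    ∫ ω, |ε j ω i| ^ m ∂μ ≤ (m.factorial : ℝ) / 2 * v ^ 2 * c ^ (m - 2)

/-- The cumulative distribution function `G_j(s) = P(d_j ≤ s)` of the `j`-th delay. -/
noncomputable def delayCDF (μ : Measure Ω) (D : ℕ → Ω → ℝ≥0∞) (j : ℕ) (s : ℝ≥0∞) : ℝ :=
  μ.real {ω | D j ω ≤ s}

/-- `∑_{j ≤ n} G_j(n - j) = Ω(n^α (log n)^β)`. -/
def DelayCondition (μ : Measure Ω) (D : ℕ → Ω → ℝ≥0∞) (α β : ℝ) : Prop :=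
  ∃ c : ℝ, 0 < c ∧ ∀ᶠ n : ℕ in atTop,
    c * ((n : ℝ) ^ α * Real.log n ^ β) ≤
      ∑ j ∈ Finset.Icc 1 n, delayCDF μ D j ((n - j : ℕ) : ℝ≥0∞)

end

end DelayedBandit

/-! The history before a pull contains all covariates and all delays, so it is known beforehand
which pulls fall in a given cell and are fast enough to be observed by time n. The only fresh
randomness at time j is the arm draw and then the error. Exponential moments can thus be bounded by
replacing one conditional factor at a time, starting from the last
(`lintegral_prod_le_lintegral_prod`).

Three Chernoff bounds carry the proof. Write B_n = n^α (log n)^β h_n^d π_n. (i) After the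
initialization every arm has conditional probability at least π_n at each time up to n, so each cell
holds at least b B_n observations of each arm, outside an event of probability exp(-b B_n)
(`measure_observed_pulls_le`). (ii) By Bernstein's condition the errors summed over the observed
pulls form an exponential supermartingale, so in a cell with that many observations the error
average is small (`measure_error_sum_ge_le`). (iii) A non-greedy pull selects an arm of conditional
probability at most π_j; as π averages to zero, such pulls have density zero
(`measure_improbable_pulls_ge_le`).

The rate condition makes the number of cells polynomial in n and B_n / log n unbounded, so union
bounds over cells are summable and Borel–Cantelli applies. With uniform continuity of f_i for the
bias, the histogram converges uniformly. The rule's estimate is a histogram from some earlier time,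
which tends to infinity because rewards keep arriving. Hence the greedy arm is eventually nearly
optimal, the other pulls are few and have bounded loss, and the strong law keeps the denominator of
the ratio linear in n. -/

namespace DelayedBandit

/-! ### Exponential moments and one-step conditioning -/

section Conditioning

variable {Ω : Type*} {m : MeasurableSpace Ω} {μ : Measure Ω}

/-- Expand the exponential. The linear term vanishes, and the moment condition cancels the
factorials, so the terms from the second on are dominated by a geometric series of ratio 1/2 with
sum t²v²; then 1 + x ≤ exp x. -/
theorem lintegral_exp_mul_le_of_bernstein [IsProbabilityMeasure μ] {Y : Ω → ℝ} {v c t : ℝ}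
    (hY : Integrable Y μ) (hY0 : ∫ ω, Y ω ∂μ = 0) (hc : 0 < c)
    (hm : ∀ k : ℕ, 2 ≤ k → Integrable (fun ω => |Y ω| ^ k) μ ∧
      ∫ ω, |Y ω| ^ k ∂μ ≤ (k.factorial : ℝ) / 2 * v ^ 2 * c ^ (k - 2))
    (ht : |t| * c ≤ 1 / 2) :
    ∫⁻ ω, ENNReal.ofReal (Real.exp (t * Y ω)) ∂μ ≤ ENNReal.ofReal (Real.exp (t ^ 2 * v ^ 2)) := by
  set F : ℕ → Ω → ℝ := fun k ω => (t * Y ω) ^ k / (k.factorial : ℝ) with hF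
  have hexp : ∀ ω, HasSum (fun k => F k ω) (Real.exp (t * Y ω)) := fun ω => by
    rw [Real.exp_eq_exp_ℝ]; exact NormedSpace.expSeries_div_hasSum_exp (t * Y ω)
  have hnorm : ∀ k ω, ‖F k ω‖ = |t| ^ k / (k.factorial : ℝ) * |Y ω| ^ k := fun k ω => by
    simp only [hF, Real.norm_eq_abs, abs_div, abs_pow, abs_mul, Nat.abs_cast, mul_pow]; ring
  have hint : ∀ k, Integrable (F k) μ := by
    intro k
    match k with
    | 0 => simp [hF]
    | 1 => simpa [hF] using hY.const_mul t
    | k + 2 =>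
      refine Integrable.mono' (((hm (k + 2) (by omega)).1).const_mul
        (|t| ^ (k + 2) / ((k + 2).factorial : ℝ))) ?_ (ae_of_all _ fun ω => (hnorm _ ω).le)
      exact (((hY.aestronglyMeasurable.const_mul t).pow (k + 2)).div₀
        aestronglyMeasurable_const)
  have hbound : ∀ k, ∫ ω, ‖F (k + 2) ω‖ ∂μ ≤ t ^ 2 * v ^ 2 / 2 * (1 / 2) ^ k := by
    intro k
    have h2 := (hm (k + 2) (by omega)).2
    have hfac : (0 : ℝ) < ((k + 2).factorial : ℝ) := by positivity
    calc ∫ ω, ‖F (k + 2) ω‖ ∂μ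
        = |t| ^ (k + 2) / ((k + 2).factorial : ℝ) * ∫ ω, |Y ω| ^ (k + 2) ∂μ := by
          rw [← integral_const_mul]; exact integral_congr_ae (ae_of_all _ fun ω => hnorm _ ω)
      _ ≤ |t| ^ (k + 2) / ((k + 2).factorial : ℝ) *
            (((k + 2).factorial : ℝ) / 2 * v ^ 2 * c ^ k) := by
          gcongr; simpa using h2
      _ = t ^ 2 * v ^ 2 / 2 * (|t| * c) ^ k := by
          rw [← sq_abs t]; field_simp; ring
      _ ≤ _ := by gcongr
  have hgeom : HasSum (fun k : ℕ => t ^ 2 * v ^ 2 / 2 * (1 / 2 : ℝ) ^ k) (t ^ 2 * v ^ 2) := by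
    convert! hasSum_geometric_two.mul_left (t ^ 2 * v ^ 2 / 2) using 1; ring
  have hsum : Summable fun k => ∫ ω, ‖F k ω‖ ∂μ := by
    rw [← summable_nat_add_iff 2]
    exact hgeom.summable.of_nonneg_of_le (fun k => integral_nonneg fun _ => norm_nonneg _) hbound
  have hS := hasSum_integral_of_summable_integral_norm hint hsum
  have htsum : (fun ω => ∑' k, F k ω) = fun ω => Real.exp (t * Y ω) := by
    ext ω; exact (hexp ω).tsum_eq
  rw [htsum] at hS
  have hmeas : AEStronglyMeasurable (fun ω => Real.exp (t * Y ω)) μ :=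
    Real.continuous_exp.comp_aestronglyMeasurable (hY.aestronglyMeasurable.const_mul t)
  have hintexp : Integrable (fun ω => Real.exp (t * Y ω)) μ := by
    refine ⟨hmeas, ?_⟩
    rw [hasFiniteIntegral_iff_enorm]
    have hle : ∀ ω, ‖Real.exp (t * Y ω)‖ₑ ≤ ∑' k, ‖F k ω‖ₑ := fun ω => by
      rw [← (hexp ω).tsum_eq]; exact enorm_tsum_le_tsum_enorm
    refine (lintegral_mono hle).trans_lt ?_
    rw [lintegral_tsum fun k => (hint k).aestronglyMeasurable.enorm]
    have : ∀ k, ∫⁻ ω, ‖F k ω‖ₑ ∂μ = ENNReal.ofReal (∫ ω, ‖F k ω‖ ∂μ) := fun k =>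
      (ofReal_integral_norm_eq_lintegral_enorm (hint k)).symm
    simp_rw [this]
    rw [← ENNReal.ofReal_tsum_of_nonneg (fun k => integral_nonneg fun _ => norm_nonneg _) hsum]
    exact ENNReal.ofReal_lt_top
  rw [← ofReal_integral_eq_lintegral_ofReal hintexp (ae_of_all _ fun _ => (Real.exp_pos _).le)]
  refine ENNReal.ofReal_le_ofReal ?_
  have h2 := (hasSum_nat_add_iff' 2).2 hS
  have hle : ∀ k, ∫ ω, F (k + 2) ω ∂μ ≤ t ^ 2 * v ^ 2 / 2 * (1 / 2) ^ k := fun k =>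
    (le_abs_self _).trans ((norm_integral_le_integral_norm _).trans (hbound k))
  have := hasSum_le hle h2 hgeom
  have h0 : ∫ ω, F 0 ω ∂μ = 1 := by simp [hF]
  have h1 : ∫ ω, F 1 ω ∂μ = 0 := by simp [hF, integral_const_mul, hY0]
  rw [Finset.sum_range_succ, Finset.sum_range_one, h0, h1] at this
  have := Real.add_one_le_exp (t ^ 2 * v ^ 2)
  linarith

/-- Sequential comparison: if each factor `g k` is, conditionally on `H k`, dominated by `b k`,
where the `b j` are measurable with respect to every `H k`, then so is the product. -/
theorem lintegral_prod_le_lintegral_prod (H : ℕ → MeasurableSpace Ω)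
    (g b : ℕ → Ω → ℝ≥0∞) {M n : ℕ} (hMn : M ≤ n)
    (hg : ∀ j k, M < j → j < k → k ≤ n → Measurable[H k] (g j))
    (hb : ∀ j k, M < j → j ≤ n → M < k → k ≤ n → Measurable[H k] (b j))
    (hstep : ∀ k, M < k → k ≤ n → ∀ W, Measurable[H k] W →
      ∫⁻ ω, W ω * g k ω ∂μ ≤ ∫⁻ ω, W ω * b k ω ∂μ) :
    ∫⁻ ω, ∏ j ∈ Finset.Ioc M n, g j ω ∂μ ≤ ∫⁻ ω, ∏ j ∈ Finset.Ioc M n, b j ω ∂μ := by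
  have key : ∀ k, M ≤ k → k ≤ n → ∀ V : Ω → ℝ≥0∞, (∀ i, M < i → i ≤ k → Measurable[H i] V) →
      ∫⁻ ω, (∏ j ∈ Finset.Ioc M k, g j ω) * V ω ∂μ ≤
        ∫⁻ ω, (∏ j ∈ Finset.Ioc M k, b j ω) * V ω ∂μ := by
    intro k hk
    induction k, hk using Nat.le_induction with
    | base => intro _ V _; simp
    | succ k hk ih =>
      intro hkn V hV
      simp_rw [Finset.prod_Ioc_succ_top hk]
      calc ∫⁻ ω, (∏ j ∈ Finset.Ioc M k, g j ω) * g (k + 1) ω * V ω ∂μ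
          = ∫⁻ ω, ((∏ j ∈ Finset.Ioc M k, g j ω) * V ω) * g (k + 1) ω ∂μ := by
            congr 1 with ω; ring
        _ ≤ ∫⁻ ω, ((∏ j ∈ Finset.Ioc M k, g j ω) * V ω) * b (k + 1) ω ∂μ := by
            refine hstep (k + 1) (by omega) hkn _ ?_
            refine Measurable.mul ?_ (hV (k + 1) (by omega) le_rfl)
            refine Finset.measurable_fun_prod _ fun j hj => ?_
            rw [Finset.mem_Ioc] at hj
            exact hg j (k + 1) hj.1 (by omega) hkn
        _ = ∫⁻ ω, (∏ j ∈ Finset.Ioc M k, g j ω) * (V ω * b (k + 1) ω) ∂μ := by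
            congr 1 with ω; ring
        _ ≤ ∫⁻ ω, (∏ j ∈ Finset.Ioc M k, b j ω) * (V ω * b (k + 1) ω) ∂μ := by
            refine ih (by omega) _ fun i hi hik => ?_
            exact (hV i hi (by omega)).mul (hb (k + 1) i (by omega) hkn hi (by omega))
        _ = _ := by congr 1 with ω; ring
  simpa using key n hMn le_rfl (fun _ => 1) fun _ _ _ => measurable_const

/-- The defining property of conditional expectation, carried from sets of `H` to nonnegative
`H`-measurable weights by monotone approximation, so that no integrability of the weight has to be
checked. -/
theorem lintegral_mul_indicator_eq_condExp {H m : MeasurableSpace Ω} {μ : Measure Ω}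
    [IsFiniteMeasure μ] (hH : H ≤ m)
    {E : Set Ω} (hE : MeasurableSet E) {W : Ω → ℝ≥0∞} (hW : Measurable[H] W) :
    ∫⁻ ω, W ω * E.indicator 1 ω ∂μ =
      ∫⁻ ω, W ω * ENNReal.ofReal ((μ[E.indicator (fun _ => (1 : ℝ)) | H]) ω) ∂μ := by
  have hint : Integrable (E.indicator (fun _ => (1 : ℝ))) μ :=
    (integrable_const (1 : ℝ)).indicator hE
  have hnn : 0 ≤ᵐ[μ] μ[E.indicator (fun _ => (1 : ℝ)) | H] :=
    condExp_nonneg (ae_of_all _ fun ω => Set.indicator_nonneg (fun _ _ => zero_le_one) ω)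
  have hqm : Measurable fun ω => ENNReal.ofReal ((μ[E.indicator (fun _ => (1 : ℝ)) | H]) ω) :=
    (stronglyMeasurable_condExp.measurable.mono hH le_rfl).ennreal_ofReal
  have hEm : Measurable (E.indicator (1 : Ω → ℝ≥0∞)) := measurable_one.indicator hE
  refine @Measurable.ennreal_induction Ω H (fun W => ∫⁻ ω, W ω * E.indicator 1 ω ∂μ =
      ∫⁻ ω, W ω * ENNReal.ofReal ((μ[E.indicator (fun _ => (1 : ℝ)) | H]) ω) ∂μ) ?_ ?_ ?_ W hW
  · intro c s hs
    have hs' := hH _ hs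
    have e1 : ∀ u : Ω → ℝ≥0∞, ∀ ω, s.indicator (fun _ => c) ω * u ω =
        c * s.indicator u ω := fun u ω => by by_cases h : ω ∈ s <;> simp [h]
    simp_rw [e1 (E.indicator 1),
      e1 fun ω => ENNReal.ofReal ((μ[E.indicator (fun _ => (1 : ℝ)) | H]) ω)]
    rw [lintegral_const_mul _ (hEm.indicator hs'), lintegral_const_mul _ (hqm.indicator hs'),
      lintegral_indicator hs', lintegral_indicator hs',
      ← ofReal_integral_eq_lintegral_ofReal integrable_condExp.integrableOn
        (ae_restrict_of_ae hnn), setIntegral_condExp hH hint hs, setIntegral_indicator hE,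
      lintegral_indicator hE]
    simp [Measure.restrict_apply, hE, Set.inter_comm, Measure.real]
  · intro f g _ hf hg ihf ihg
    simp_rw [Pi.add_apply, add_mul]
    rw [lintegral_add_left ((hf.mono hH le_rfl).fun_mul hEm),
      lintegral_add_left ((hf.mono hH le_rfl).fun_mul hqm), ihf, ihg]
  · intro f hf hmono ih
    simp_rw [ENNReal.iSup_mul]
    rw [lintegral_iSup (fun n => ((hf n).mono hH le_rfl).fun_mul hEm)
        (fun i j hij ω => mul_le_mul_left (hmono hij ω) _),
      lintegral_iSup (fun n => ((hf n).mono hH le_rfl).fun_mul hqm)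
        (fun i j hij ω => mul_le_mul_left (hmono hij ω) _)]
    simp_rw [ih]

/-- Supplies the single step of the sequential comparison for an arm draw: the conditional mean of
the factor is u q + v (1 - q), where q is the conditional probability of `E`. The bound is required
only for q in [0,1], where q lies almost surely. -/
theorem lintegral_mul_ite_le {H m : MeasurableSpace Ω} {μ : Measure Ω}
    [IsProbabilityMeasure μ] (hH : H ≤ m)
    {E : Set Ω} [DecidablePred (· ∈ E)] (hE : MeasurableSet E) {W u v b : Ω → ℝ≥0∞}
    (hW : Measurable[H] W)
    (hu : Measurable[H] u) (hv : Measurable[H] v)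
    (hb : ∀ ω, ∀ q : ℝ, q = (μ[E.indicator (fun _ => (1 : ℝ)) | H]) ω → 0 ≤ q → q ≤ 1 →
      u ω * ENNReal.ofReal q + v ω * ENNReal.ofReal (1 - q) ≤ b ω) :
    ∫⁻ ω, W ω * (if ω ∈ E then u ω else v ω) ∂μ ≤ ∫⁻ ω, W ω * b ω ∂μ := by
  have hint : ∀ {E : Set Ω}, MeasurableSet E → Integrable (E.indicator (fun _ => (1 : ℝ))) μ :=
    fun hE => (integrable_const (1 : ℝ)).indicator hE
  have hnn : ∀ E : Set Ω, 0 ≤ᵐ[μ] μ[E.indicator (fun _ => (1 : ℝ)) | H] := fun E =>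
    condExp_nonneg (ae_of_all _ fun ω => Set.indicator_nonneg (fun _ _ => zero_le_one) ω)
  have hcompl : ∀ᵐ ω ∂μ, (μ[Eᶜ.indicator (fun _ => (1 : ℝ)) | H]) ω =
      1 - (μ[E.indicator (fun _ => (1 : ℝ)) | H]) ω := by
    have h1 : Eᶜ.indicator (fun _ => (1 : ℝ)) = (fun _ => 1) - E.indicator (fun _ => (1 : ℝ)) := by
      rw [Set.indicator_compl]
    rw [h1]
    filter_upwards [condExp_sub (integrable_const (1 : ℝ)) (hint hE) H] with ω hω
    rw [hω, condExp_const hH, Pi.sub_apply]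
  have hm' : ∀ {w : Ω → ℝ≥0∞}, Measurable[H] w → Measurable w := fun hw => hw.mono hH le_rfl
  have hqm : ∀ E : Set Ω,
      Measurable fun ω => ENNReal.ofReal ((μ[E.indicator (fun _ => (1 : ℝ)) | H]) ω) := fun E =>
    (stronglyMeasurable_condExp.measurable.mono hH le_rfl).ennreal_ofReal
  calc ∫⁻ ω, W ω * (if ω ∈ E then u ω else v ω) ∂μ
      = ∫⁻ ω, (W ω * u ω) * E.indicator 1 ω + (W ω * v ω) * Eᶜ.indicator 1 ω ∂μ := by
        congr 1 with ω; by_cases h : ω ∈ E <;> simp [h]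
    _ = ∫⁻ ω, (W ω * u ω) * ENNReal.ofReal ((μ[E.indicator (fun _ => (1 : ℝ)) | H]) ω) ∂μ +
        ∫⁻ ω, (W ω * v ω) * ENNReal.ofReal ((μ[Eᶜ.indicator (fun _ => (1 : ℝ)) | H]) ω) ∂μ := by
        rw [lintegral_add_left (((hm' hW).fun_mul (hm' hu)).fun_mul (measurable_one.indicator hE)),
          lintegral_mul_indicator_eq_condExp hH hE (hW.fun_mul hu),
          lintegral_mul_indicator_eq_condExp hH hE.compl (hW.fun_mul hv)]
    _ = ∫⁻ ω, (W ω * u ω) * ENNReal.ofReal ((μ[E.indicator (fun _ => (1 : ℝ)) | H]) ω) +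
        (W ω * v ω) * ENNReal.ofReal ((μ[Eᶜ.indicator (fun _ => (1 : ℝ)) | H]) ω) ∂μ :=
        (lintegral_add_left (((hm' hW).fun_mul (hm' hu)).fun_mul (hqm E)) _).symm
    _ ≤ _ := by
        refine lintegral_mono_ae ?_
        filter_upwards [hcompl, hnn E, hnn Eᶜ] with ω h1 h2 h3
        rw [h1, mul_assoc, mul_assoc, ← mul_add]
        simp only [Pi.zero_apply, h1] at h2 h3
        gcongr
        exact hb ω _ rfl h2 (by linarith)

theorem ae_eventually_notMem_of_eventually_le {s : ℕ → Set Ω} {a : ℕ → ℝ} [IsFiniteMeasure μ]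
    (ha : Summable a) (h : ∀ᶠ n in atTop, μ (s n) ≤ ENNReal.ofReal (a n)) :
    ∀ᵐ ω ∂μ, ∀ᶠ n in atTop, ω ∉ s n := by
  obtain ⟨N, hN⟩ := eventually_atTop.1 h
  have : ∑' n, μ (s (n + N)) ≠ ∞ := by
    have h1 : Summable fun n => a (n + N) := (summable_nat_add_iff N).2 ha
    refine ne_top_of_le_ne_top h1.tsum_ofReal_ne_top (ENNReal.tsum_le_tsum fun n => ?_)
    exact hN _ (by omega)
  filter_upwards [ae_eventually_notMem this] with ω hω
  obtain ⟨K, hK⟩ := eventually_atTop.1 hω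
  refine eventually_atTop.2 ⟨K + N, fun n hn => ?_⟩
  have := hK (n - N) (by omega)
  rwa [Nat.sub_add_cancel (by omega)] at this

end Conditioning

/-! ### Chernoff bounds for the bandit process -/

section ModelBounds

/-- Markov's inequality in exponential form. `S` need not be measurable, so the events to which it
is applied need no measurability proof. -/
theorem measure_le_exp_of_lintegral_le {Ω : Type*} {m : MeasurableSpace Ω} {μ : Measure Ω}
    {f : Ω → ℝ≥0∞} (hf : Measurable f) {a r : ℝ} (ha : ∫⁻ ω, f ω ∂μ ≤ ENNReal.ofReal (Real.exp a))
    {S : Set Ω} (hS : ∀ ω ∈ S, ENNReal.ofReal (Real.exp r) ≤ f ω) :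
    μ S ≤ ENNReal.ofReal (Real.exp (a - r)) := by
  calc μ S ≤ μ {ω | ENNReal.ofReal (Real.exp r) ≤ f ω} := measure_mono hS
    _ ≤ (∫⁻ ω, f ω ∂μ) / ENNReal.ofReal (Real.exp r) :=
        meas_ge_le_lintegral_div hf.aemeasurable (by simp [Real.exp_pos]) ENNReal.ofReal_ne_top
    _ ≤ ENNReal.ofReal (Real.exp a) / ENNReal.ofReal (Real.exp r) := by gcongr
    _ = _ := by rw [← ENNReal.ofReal_div_of_pos (Real.exp_pos r), Real.exp_sub]

theorem prod_ite_exp_eq {ι : Type*} (s : Finset ι) (p : ι → Prop) [DecidablePred p] (t : ι → ℝ) :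
    ∏ j ∈ s, (if p j then ENNReal.ofReal (Real.exp (t j)) else 1) =
      ENNReal.ofReal (Real.exp (∑ j ∈ s with p j, t j)) := by
  rw [← Finset.prod_filter, ← ENNReal.ofReal_prod_of_nonneg fun _ _ => (Real.exp_pos _).le,
    Real.exp_sum]

variable {Ω : Type*} {ℓ d : ℕ} {X : ℕ → Ω → Fin d → ℝ} {ε : ℕ → Ω → Fin ℓ → ℝ}
  {D : ℕ → Ω → ℝ≥0∞} {I : ℕ → Ω → Fin ℓ}

theorem measurable_covariate_history {j : ℕ} (hj : 1 ≤ j) (k : ℕ) :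
    Measurable[history X ε D I k] (X j) := by
  refine Measurable.of_comap_le ?_
  refine le_trans ?_ (le_sup_left.trans (le_sup_left.trans le_sup_left))
  exact le_iSup₂_of_le j hj le_rfl

theorem measurable_delay_history {j : ℕ} (hj : 1 ≤ j) (k : ℕ) :
    Measurable[history X ε D I k] (D j) := by
  refine Measurable.of_comap_le ?_
  refine le_trans ?_ (le_sup_right.trans (le_sup_left.trans le_sup_left))
  exact le_iSup₂_of_le j hj le_rfl

theorem measurable_error_history {j k : ℕ} (hj : 1 ≤ j) (hjk : j < k) :
    Measurable[history X ε D I k] (ε j) := by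
  refine Measurable.of_comap_le ?_
  refine le_trans ?_ (le_sup_right.trans le_sup_left)
  exact le_iSup₂_of_le j ⟨hj, hjk⟩ le_rfl

theorem measurable_arm_history {j k : ℕ} (hj : 1 ≤ j) (hjk : j < k) :
    Measurable[history X ε D I k] (I j) := by
  refine Measurable.of_comap_le ?_
  refine le_trans ?_ le_sup_right
  exact le_iSup₂_of_le j ⟨hj, hjk⟩ le_rfl

theorem history_mono {j k : ℕ} (hjk : j ≤ k) : history X ε D I j ≤ history X ε D I k := by
  refine sup_le_sup (sup_le_sup le_rfl ?_) ?_ <;>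
  exact biSup_mono fun i hi => ⟨hi.1, hi.2.trans_le hjk⟩

theorem history_sup_arm_le {j k : ℕ} (hj : 1 ≤ j) (hjk : j < k) :
    history X ε D I j ⊔ MeasurableSpace.comap (I j) inferInstance ≤ history X ε D I k :=
  sup_le (history_mono hjk.le) (measurable_arm_history hj hjk).comap_le

theorem measurableSet_arm_history (i : Fin ℓ) {j k : ℕ} (hj : 1 ≤ j) (hjk : j < k) :
    MeasurableSet[history X ε D I k] {ω | I j ω = i} :=
  measurable_arm_history hj hjk (measurableSet_singleton i)

theorem measurableSet_covariate_delay_history {C : Set (Fin d → ℝ)} (hC : MeasurableSet C)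
    (s : ℝ≥0∞) {j : ℕ} (hj : 1 ≤ j) (k : ℕ) :
    MeasurableSet[history X ε D I k] {ω | X j ω ∈ C ∧ D j ω ≤ s} :=
  MeasurableSet.inter (measurable_covariate_history hj k hC)
    (measurable_delay_history hj k measurableSet_Iic)

variable [mΩ : MeasurableSpace Ω] {μ : Measure Ω} {PX : Measure (Fin d → ℝ)}

/-- The conditional probability, given the history, that arm `i` is pulled at time `k`. -/
noncomputable def armProb (μ : Measure Ω) (X : ℕ → Ω → Fin d → ℝ) (ε : ℕ → Ω → Fin ℓ → ℝ)
    (D : ℕ → Ω → ℝ≥0∞) (I : ℕ → Ω → Fin ℓ) (i : Fin ℓ) (k : ℕ) : Ω → ℝ :=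
  μ[Set.indicator {ω | I k ω = i} (fun _ => (1 : ℝ)) | history X ε D I k]

theorem history_le (hmodel : IsModel μ PX X ε D I) (k : ℕ) : history X ε D I k ≤ mΩ :=
  sup_le (sup_le (sup_le
    (iSup₂_le fun j hj => (hmodel.measurable_covariate j hj).comap_le)
    (iSup₂_le fun j hj => (hmodel.measurable_delay j hj).comap_le))
    (iSup₂_le fun j hj => (hmodel.measurable_error j hj.1).comap_le))
    (iSup₂_le fun j hj => (hmodel.measurable_arm j hj.1).comap_le)

theorem measurable_armProb_history (i : Fin ℓ) {j k : ℕ} (hjk : j ≤ k) :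
    Measurable[history X ε D I k] (armProb μ X ε D I i j) :=
  stronglyMeasurable_condExp.measurable.mono (history_mono hjk) le_rfl

theorem measurableSet_arm (hmodel : IsModel μ PX X ε D I) (i : Fin ℓ) {j : ℕ} (hj : 1 ≤ j) :
    MeasurableSet {ω | I j ω = i} :=
  hmodel.measurable_arm j hj (measurableSet_singleton i)

/-- Independence of the two sequences separates covariates from delays; independence within each
sequence then splits both parts over the indices. -/
theorem measure_biInter_covariate_delay (hmodel : IsModel μ PX X ε D I)
    {C : Set (Fin d → ℝ)} (hC : MeasurableSet C) (s : ℕ → ℝ≥0∞) (S : Finset ℕ) :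
    μ (⋂ j ∈ S, {ω | X (j + 1) ω ∈ C ∧ D (j + 1) ω ≤ s (j + 1)}) =
      ∏ j ∈ S, PX C * μ {ω | D (j + 1) ω ≤ s (j + 1)} := by
  have h1 : (⋂ j ∈ S, {ω | X (j + 1) ω ∈ C ∧ D (j + 1) ω ≤ s (j + 1)}) =
      (fun ω (j : ℕ) => X (j + 1) ω) ⁻¹' (⋂ j ∈ S, {x | x j ∈ C}) ∩
      (fun ω (j : ℕ) => D (j + 1) ω) ⁻¹' (⋂ j ∈ S, {x | x j ≤ s (j + 1)}) := by
    ext ω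
    simp only [Set.mem_iInter, Set.mem_ofPred_eq, Set.mem_inter_iff, Set.mem_preimage]
    exact ⟨fun h => ⟨fun j hj => (h j hj).1, fun j hj => (h j hj).2⟩,
      fun h j hj => ⟨h.1 j hj, h.2 j hj⟩⟩
  have h2 : MeasurableSet (⋂ j ∈ S, {x : ℕ → Fin d → ℝ | x j ∈ C}) :=
    S.measurableSet_biInter fun j _ => measurable_pi_apply j hC
  have h3 : MeasurableSet (⋂ j ∈ S, {x : ℕ → ℝ≥0∞ | x j ≤ s (j + 1)}) :=
    S.measurableSet_biInter fun j _ => measurable_pi_apply j measurableSet_Iic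
  rw [h1, hmodel.covariate_delay_indep.measure_inter_preimage_eq_mul _ _ h2 h3,
    Finset.prod_mul_distrib]
  congr 1
  · rw [Set.preimage_iInter₂]
    refine (hmodel.covariate_indep.measure_inter_preimage_eq_mul S (sets := fun _ => C)
      fun _ _ => hC).trans (Finset.prod_congr rfl fun j _ => ?_)
    rw [← hmodel.covariate_law (j + 1) (by omega),
      Measure.map_apply (hmodel.measurable_covariate _ (by omega)) hC]
  · rw [Set.preimage_iInter₂]
    exact hmodel.delay_indep.measure_inter_preimage_eq_mul S (sets := fun j => Set.Iic (s (j + 1)))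
      fun _ _ => measurableSet_Iic

theorem measure_covariate_delay (hmodel : IsModel μ PX X ε D I)
    {C : Set (Fin d → ℝ)} (hC : MeasurableSet C) (s : ℕ → ℝ≥0∞) (j : ℕ) :
    μ {ω | X (j + 1) ω ∈ C ∧ D (j + 1) ω ≤ s (j + 1)} =
      PX C * μ {ω | D (j + 1) ω ≤ s (j + 1)} := by
  simpa using measure_biInter_covariate_delay hmodel hC s {j}

theorem iIndepSet_covariate_delay (hmodel : IsModel μ PX X ε D I)
    {C : Set (Fin d → ℝ)} (hC : MeasurableSet C) (s : ℕ → ℝ≥0∞) :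
    iIndepSet (fun j => {ω | X (j + 1) ω ∈ C ∧ D (j + 1) ω ≤ s (j + 1)}) μ := by
  refine (iIndepSet_iff_meas_biInter fun j => ?_).2 fun S => ?_
  · exact history_le hmodel 0 _ (measurableSet_covariate_delay_history hC _ (by omega) 0)
  · simp_rw [measure_biInter_covariate_delay hmodel hC s, measure_covariate_delay hmodel hC s]

theorem lintegral_prod_ite_of_iIndepSet [IsProbabilityMeasure μ] {A : ℕ → Set Ω}
    [∀ j, DecidablePred (· ∈ A j)]
    (hA : ∀ j, MeasurableSet (A j)) (hind : iIndepSet A μ) {ρ : ℝ} (hρ1 : ρ ≤ 1)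
    (S : Finset ℕ) :
    ∫⁻ ω, ∏ j ∈ S, (if ω ∈ A j then ENNReal.ofReal (1 - ρ) else 1) ∂μ ≤
      ENNReal.ofReal (Real.exp (-(ρ * ∑ j ∈ S, μ.real (A j)))) := by
  classical
  have hφ : Measurable fun y : ℝ => if y = 1 then ENNReal.ofReal (1 - ρ) else 1 :=
    Measurable.ite (measurableSet_singleton _) measurable_const measurable_const
  have h1 := (hind.iIndepFun_indicator (β := ℝ)).comp
    (fun _ y => if y = 1 then ENNReal.ofReal (1 - ρ) else 1) fun _ => hφ
  have h2 : ∀ j, ((fun y : ℝ => if y = 1 then ENNReal.ofReal (1 - ρ) else 1) ∘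
      (A j).indicator fun _ => 1) = fun ω => if ω ∈ A j then ENNReal.ofReal (1 - ρ) else 1 := by
    intro j; ext ω; by_cases h : ω ∈ A j <;> simp [h]
  simp_rw [h2] at h1
  rw [lintegral_prod_eq_prod_lintegral_of_indepFun S _ h1
    fun j => Measurable.ite (hA j) measurable_const measurable_const]
  rw [Finset.mul_sum, ← Finset.sum_neg_distrib, Real.exp_sum,
    ENNReal.ofReal_prod_of_nonneg fun _ _ => (Real.exp_pos _).le]
  refine Finset.prod_le_prod' fun j _ => ?_
  have h3 : (fun ω => if ω ∈ A j then ENNReal.ofReal (1 - ρ) else 1) = fun ω =>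
      (A j).indicator (fun _ => ENNReal.ofReal (1 - ρ)) ω + (A j)ᶜ.indicator (fun _ => 1) ω := by
    ext ω; by_cases h : ω ∈ A j <;> simp [h]
  have hp : μ (A j) = ENNReal.ofReal (μ.real (A j)) := (ofReal_measureReal).symm
  have hp' : μ (A j)ᶜ = ENNReal.ofReal (1 - μ.real (A j)) := by
    rw [← probReal_compl_eq_one_sub (hA j), ofReal_measureReal]
  have hle : μ.real (A j) ≤ 1 := measureReal_le_one
  rw [h3, lintegral_add_left (measurable_const.indicator (hA j)), lintegral_indicator_const (hA j),
    lintegral_indicator_const (hA j).compl, hp, hp', one_mul,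
    ← ENNReal.ofReal_mul (by linarith),
    ← ENNReal.ofReal_add (mul_nonneg (by linarith) measureReal_nonneg) (by linarith)]
  refine ENNReal.ofReal_le_ofReal ?_
  have := Real.add_one_le_exp (-(ρ * μ.real (A j)))
  linarith

-- The alternative `armProb < ρ` removes the random initialization time: an index is either counted
-- outright or has probability at least ρ of being counted, so the bound is unconditional. Once the
-- initialization is over the alternative cannot occur, and true pulls remain. Given the history, an
-- eligible index contributes a factor of mean at most 1 - ρ/2, and eligibility is independent
-- across indices.
open Classical in
theorem measure_observed_pulls_le [IsProbabilityMeasure μ] (hmodel : IsModel μ PX X ε D I)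
    {C : Set (Fin d → ℝ)} (hC : MeasurableSet C) (s : ℕ → ℝ≥0∞) (i : Fin ℓ) {ρ : ℝ}
    (hρ1 : ρ ≤ 1) {M n : ℕ} (hMn : M ≤ n) (B : ℝ) :
    μ {ω | (((Finset.Ioc M n).filter fun j => (X j ω ∈ C ∧ D j ω ≤ s j) ∧
        (I j ω = i ∨ armProb μ X ε D I i j ω < ρ)).card : ℝ) ≤ B} ≤
      ENNReal.ofReal (Real.exp (B -
        ρ / 2 * (PX.real C * ∑ j ∈ Finset.Ioc M n, delayCDF μ D j (s j)))) := by
  set A : ℕ → Set Ω := fun j => {ω | X j ω ∈ C ∧ D j ω ≤ s j} with hA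
  set q : ℕ → Ω → ℝ := armProb μ X ε D I i with hq
  set c : ℝ≥0∞ := ENNReal.ofReal (Real.exp (-1)) with hc
  set u : ℕ → Ω → ℝ≥0∞ := fun j ω => if ω ∈ A j then c else 1 with hu
  set v : ℕ → Ω → ℝ≥0∞ := fun j ω => if ω ∈ A j ∧ q j ω < ρ then c else 1 with hv
  set g : ℕ → Ω → ℝ≥0∞ := fun j ω => if ω ∈ {ω | I j ω = i} then u j ω else v j ω with hg
  set b : ℕ → Ω → ℝ≥0∞ := fun j ω => if ω ∈ A j then ENNReal.ofReal (1 - ρ / 2) else 1 with hb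
  have hAm : ∀ {j}, 1 ≤ j → ∀ k, MeasurableSet[history X ε D I k] (A j) := fun hj k =>
    measurableSet_covariate_delay_history hC _ hj k
  have hum : ∀ {j}, 1 ≤ j → ∀ k, Measurable[history X ε D I k] (u j) := fun hj k =>
    Measurable.ite (hAm hj k) measurable_const measurable_const
  have hvm : ∀ {j k}, 1 ≤ j → j ≤ k → Measurable[history X ε D I k] (v j) := fun hj hjk =>
    Measurable.ite ((hAm hj _).inter (measurable_armProb_history i hjk measurableSet_Iio))
      measurable_const measurable_const
  have hgm : ∀ {j k}, 1 ≤ j → j < k → Measurable[history X ε D I k] (g j) := fun hj hjk =>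
    Measurable.ite (measurableSet_arm_history i hj hjk) (hum hj _) (hvm hj hjk.le)
  -- This gives p/e + 1 - p ≤ 1 - p/2, and covers the case p < ρ because 1/2 ≤ 1 - ρ/2.
  have hexp : Real.exp (-1) ≤ 1 / 2 := by
    rw [Real.exp_neg, one_div]
    exact inv_anti₀ two_pos (by linarith [Real.add_one_le_exp (1 : ℝ)])
  have hcmp := lintegral_prod_le_lintegral_prod (μ := μ) (history X ε D I) g b hMn
    (fun j k hj hjk _ => hgm (by omega) hjk)
    (fun j k hj _ _ _ =>
      Measurable.ite (hAm (show 1 ≤ j by omega) k) measurable_const measurable_const)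
    (fun k hk _ W hW => by
      refine lintegral_mul_ite_le (μ := μ) (history_le hmodel k)
        (measurableSet_arm hmodel i (show 1 ≤ k by omega)) hW
        (hum (show 1 ≤ k by omega) k) (hvm (show 1 ≤ k by omega) le_rfl) fun ω p hp hp0 hp1 => ?_
      replace hp : p = q k ω := hp
      have hone : ENNReal.ofReal p + ENNReal.ofReal (1 - p) = 1 := by
        rw [← ENNReal.ofReal_add hp0 (by linarith)]; simp
      by_cases hω : ω ∈ A k
      · by_cases hlt : p < ρ
        · simp only [hu, hv, hb, hω, ← hp, hlt, if_true, and_self]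
          rw [← mul_add, hone, mul_one]
          exact ENNReal.ofReal_le_ofReal (by linarith)
        · simp only [hu, hv, hb, hω, ← hp, hlt, if_true, and_false, if_false, one_mul]
          rw [hc, ← ENNReal.ofReal_mul (Real.exp_pos _).le,
            ← ENNReal.ofReal_add (mul_nonneg (Real.exp_pos _).le hp0) (by linarith)]
          refine ENNReal.ofReal_le_ofReal ?_
          nlinarith
      · simp [hu, hv, hb, hω, hone])
  have hbound : ∫⁻ ω, ∏ j ∈ Finset.Ioc M n, b j ω ∂μ ≤ ENNReal.ofReal (Real.exp
      (-(ρ / 2 * (PX.real C * ∑ j ∈ Finset.Ioc M n, delayCDF μ D j (s j))))) := by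
    have hshift : Finset.Ioc M n = Finset.Ico (M + 1) (n + 1) := by
      ext j; simp only [Finset.mem_Ioc, Finset.mem_Ico]; omega
    rw [hshift, ← Finset.sum_Ico_add']
    simp_rw [← Finset.prod_Ico_add']
    refine (lintegral_prod_ite_of_iIndepSet (ρ := ρ / 2) (A := fun j => A (j + 1))
      (fun j => history_le hmodel 0 _ (hAm (by omega) 0))
      (iIndepSet_covariate_delay hmodel hC s) (by linarith) _).trans_eq ?_
    congr 4
    rw [Finset.mul_sum]
    refine Finset.sum_congr rfl fun j _ => ?_
    simp only [Measure.real, delayCDF, hA]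
    rw [measure_covariate_delay hmodel hC s, ENNReal.toReal_mul]
  refine (measure_le_exp_of_lintegral_le (r := -B) ?_ (hcmp.trans hbound)
    fun ω hω => ?_).trans_eq ?_
  · refine Finset.measurable_fun_prod _ fun j hj => ?_
    rw [Finset.mem_Ioc] at hj
    exact (hgm (by omega) (Nat.lt_succ_self j)).mono (history_le hmodel _) le_rfl
  · have : ∀ j, g j ω = if (X j ω ∈ C ∧ D j ω ≤ s j) ∧ (I j ω = i ∨ q j ω < ρ) then
        ENNReal.ofReal (Real.exp (-1)) else 1 := fun j => by
      by_cases h1 : I j ω = i <;> simp [hg, hu, hv, hA, h1, hc]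
    simp_rw [this]
    rw [prod_ite_exp_eq _ _ fun _ => -1]
    refine ENNReal.ofReal_le_ofReal (Real.exp_le_exp.2 ?_)
    simpa using hω
  · congr 2; ring

-- The compensated exponentials form a supermartingale along the selected indices: membership of j
-- is decided by the history and the arm at j, of which the error at j is independent. The sign of t
-- is free, which gives both tails.
open Classical in
theorem measure_error_sum_ge_le [IsProbabilityMeasure μ] (hmodel : IsModel μ PX X ε D I)
    {v c : ℝ} (hc : 0 < c) (hbern : ∀ j, 1 ≤ j → ∀ i, ∀ m : ℕ, 2 ≤ m →
      Integrable (fun ω => |ε j ω i| ^ m) μ ∧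
      ∫ ω, |ε j ω i| ^ m ∂μ ≤ (m.factorial : ℝ) / 2 * v ^ 2 * c ^ (m - 2))
    {C : Set (Fin d → ℝ)} (hC : MeasurableSet C) (s : ℕ → ℝ≥0∞) (i : Fin ℓ) (n : ℕ) {t : ℝ}
    (ht : |t| * c ≤ 1 / 2) (r : ℝ) :
    μ {ω | r ≤ ∑ j ∈ Finset.Ioc 0 n with I j ω = i ∧ X j ω ∈ C ∧ D j ω ≤ s j,
        (t * ε j ω i - t ^ 2 * v ^ 2)} ≤ ENNReal.ofReal (Real.exp (-r)) := by
  set U : ℕ → Set Ω := fun j => {ω | I j ω = i ∧ X j ω ∈ C ∧ D j ω ≤ s j} with hU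
  set G : ℕ → Ω → ℝ≥0∞ := fun j ω =>
    ENNReal.ofReal (Real.exp (t * ε j ω i - t ^ 2 * v ^ 2)) with hG
  set g : ℕ → Ω → ℝ≥0∞ := fun j ω => if ω ∈ U j then G j ω else 1 with hg
  set H : ℕ → MeasurableSpace Ω := fun k =>
    history X ε D I k ⊔ MeasurableSpace.comap (I k) inferInstance with hH
  have hHle : ∀ {k}, 1 ≤ k → H k ≤ mΩ := fun hk =>
    sup_le (history_le hmodel _) (hmodel.measurable_arm _ hk).comap_le
  have hUm : ∀ {j}, 1 ≤ j → MeasurableSet[H j] (U j) := fun {j} hj => by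
    refine @MeasurableSet.inter Ω (H j) _ _ ?_ ?_
    · exact (le_sup_right : _ ≤ H j) _ ⟨{i}, measurableSet_singleton i, rfl⟩
    · exact (le_sup_left : _ ≤ H j) _ (measurableSet_covariate_delay_history hC _ hj j)
  have hGε : ∀ j, Measurable[MeasurableSpace.comap (ε j) inferInstance] (G j) := fun j => by
    have hpi : Measurable fun e : Fin ℓ → ℝ =>
        ENNReal.ofReal (Real.exp (t * e i - t ^ 2 * v ^ 2)) := by fun_prop
    exact hpi.comp (comap_measurable (ε j))
  have hgm : ∀ {j k}, 1 ≤ j → j < k → Measurable[history X ε D I k] (g j) := fun {j k} hj hjk => by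
    refine Measurable.ite (history_sup_arm_le hj hjk _ (hUm hj)) ?_ measurable_const
    exact (hGε j).mono (measurable_error_history hj hjk).comap_le le_rfl
  have hGle : ∀ {j}, 1 ≤ j → ∫⁻ ω, G j ω ∂μ ≤ 1 := fun {j} hj => by
    have hmgf := lintegral_exp_mul_le_of_bernstein (hmodel.error_mean j hj i).1
      (hmodel.error_mean j hj i).2 hc (fun m hm => hbern j hj i m hm) ht
    have hsplit : ∀ ω, G j ω = ENNReal.ofReal (Real.exp (-(t ^ 2 * v ^ 2))) *
        ENNReal.ofReal (Real.exp (t * ε j ω i)) := fun ω => by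
      rw [← ENNReal.ofReal_mul (Real.exp_pos _).le, ← Real.exp_add]
      simp only [hG]; congr 2; ring
    simp_rw [hsplit]
    rw [lintegral_const_mul' _ _ ENNReal.ofReal_ne_top]
    refine (mul_le_mul_right hmgf _).trans_eq ?_
    rw [← ENNReal.ofReal_mul (Real.exp_pos _).le, ← Real.exp_add]; simp
  have hcmp := lintegral_prod_le_lintegral_prod (μ := μ) H g (fun _ _ => 1) (Nat.zero_le n)
    (fun j k hj hjk _ => (hgm (by omega) hjk).mono le_sup_left le_rfl)
    (fun j k _ _ _ _ => measurable_const)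
    (fun k hk _ W hW => by
      have hk1 : 1 ≤ k := by omega
      have hUk := hUm hk1
      have hWU : Measurable[H k] ((U k).indicator W) := hW.indicator hUk
      have hWU' : Measurable[H k] ((U k)ᶜ.indicator W) := hW.indicator hUk.compl
      calc ∫⁻ ω, W ω * g k ω ∂μ
          = ∫⁻ ω, (U k)ᶜ.indicator W ω + (U k).indicator W ω * G k ω ∂μ := by
            congr 1 with ω; by_cases h : ω ∈ U k <;> simp [hg, h]
        _ = ∫⁻ ω, (U k)ᶜ.indicator W ω ∂μ + (∫⁻ ω, (U k).indicator W ω ∂μ) * ∫⁻ ω, G k ω ∂μ := by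
            rw [lintegral_add_left (hWU'.mono (hHle hk1) le_rfl),
              lintegral_mul_eq_lintegral_mul_lintegral_of_independent_measurableSpace (hHle hk1)
                (hmodel.measurable_error k hk1).comap_le (hmodel.error_indep k hk1).symm hWU
                (hGε k)]
        _ ≤ ∫⁻ ω, (U k)ᶜ.indicator W ω ∂μ + (∫⁻ ω, (U k).indicator W ω ∂μ) * 1 := by
            gcongr; exact hGle hk1
        _ = ∫⁻ ω, W ω * 1 ∂μ := by
            rw [mul_one, ← lintegral_add_left (hWU'.mono (hHle hk1) le_rfl)]
            congr 1 with ω; by_cases h : ω ∈ U k <;> simp [h])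
  refine (measure_le_exp_of_lintegral_le (r := r) (a := 0) ?_ (hcmp.trans ?_)
    fun ω hω => ?_).trans_eq ?_
  · refine Finset.measurable_fun_prod _ fun j hj => ?_
    rw [Finset.mem_Ioc] at hj
    exact (hgm (by omega) (Nat.lt_succ_self j)).mono (history_le hmodel _) le_rfl
  · simp
  · have : ∀ j, g j ω = if I j ω = i ∧ X j ω ∈ C ∧ D j ω ≤ s j then
        ENNReal.ofReal (Real.exp (t * ε j ω i - t ^ 2 * v ^ 2)) else 1 := fun j => rfl
    simp_rw [this]
    rw [prod_ite_exp_eq _ _ fun j => t * ε j ω i - t ^ 2 * v ^ 2]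
    exact ENNReal.ofReal_le_ofReal (Real.exp_le_exp.2 hω)
  · simp

-- Each counted pull has conditional probability at most ρ_j, so its factor has conditional mean at
-- most 1 + (e - 1) ρ_j ≤ exp (2 ρ_j). Working with `armProb`, which is measurable for the history
-- by construction, avoids proving the estimates measurable.
open Classical in
theorem measure_improbable_pulls_ge_le [IsProbabilityMeasure μ] (hmodel : IsModel μ PX X ε D I)
    (i : Fin ℓ) (ρ : ℕ → ℝ) (hρ : ∀ j, 1 ≤ j → 0 ≤ ρ j) (n : ℕ) (r : ℝ) :
    μ {ω | r ≤ (((Finset.Ioc 0 n).filter fun j =>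
        I j ω = i ∧ armProb μ X ε D I i j ω ≤ ρ j).card : ℝ)} ≤
      ENNReal.ofReal (Real.exp (2 * ∑ j ∈ Finset.Ioc 0 n, ρ j - r)) := by
  set q : ℕ → Ω → ℝ := armProb μ X ε D I i with hq
  set u : ℕ → Ω → ℝ≥0∞ := fun j ω =>
    if q j ω ≤ ρ j then ENNReal.ofReal (Real.exp 1) else 1 with hu
  set g : ℕ → Ω → ℝ≥0∞ := fun j ω => if ω ∈ {ω | I j ω = i} then u j ω else 1 with hg
  have hum : ∀ {j k}, j ≤ k → Measurable[history X ε D I k] (u j) := fun hjk =>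
    Measurable.ite (measurable_armProb_history i hjk measurableSet_Iic)
      measurable_const measurable_const
  have hgm : ∀ {j k}, 1 ≤ j → j < k → Measurable[history X ε D I k] (g j) := fun hj hjk =>
    Measurable.ite (measurableSet_arm_history i hj hjk) (hum hjk.le) measurable_const
  have hcmp := lintegral_prod_le_lintegral_prod (μ := μ) (history X ε D I) g
    (fun j _ => ENNReal.ofReal (Real.exp (2 * ρ j))) (Nat.zero_le n)
    (fun j k hj hjk _ => hgm (by omega) hjk)
    (fun j k _ _ _ _ => measurable_const)
    (fun k hk _ W hW => by
      refine lintegral_mul_ite_le (μ := μ) (history_le hmodel k)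
        (measurableSet_arm hmodel i (show 1 ≤ k by omega)) hW
        (hum le_rfl) measurable_const fun ω p hp hp0 hp1 => ?_
      replace hp : p = q k ω := hp
      have hρk := hρ k (by omega)
      have h2 := Real.add_one_le_exp (2 * ρ k)
      by_cases hle : p ≤ ρ k
      · simp only [hu, ← hp, hle, if_true, one_mul]
        rw [← ENNReal.ofReal_mul (Real.exp_pos _).le,
          ← ENNReal.ofReal_add (mul_nonneg (Real.exp_pos _).le hp0) (by linarith)]
        refine ENNReal.ofReal_le_ofReal ?_
        nlinarith [Real.exp_one_lt_d9]
      · simp only [hu, ← hp, hle, if_false, one_mul]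
        rw [← ENNReal.ofReal_add hp0 (by linarith)]
        exact ENNReal.ofReal_le_ofReal (by linarith))
  refine (measure_le_exp_of_lintegral_le (r := r) (a := 2 * ∑ j ∈ Finset.Ioc 0 n, ρ j) ?_
    (hcmp.trans ?_) fun ω hω => ?_)
  · refine Finset.measurable_fun_prod _ fun j hj => ?_
    rw [Finset.mem_Ioc] at hj
    exact (hgm (by omega) (Nat.lt_succ_self j)).mono (history_le hmodel _) le_rfl
  · rw [lintegral_const, measure_univ, mul_one, Finset.mul_sum, Real.exp_sum,
      ENNReal.ofReal_prod_of_nonneg fun _ _ => (Real.exp_pos _).le]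
  · have : ∀ j, g j ω = if I j ω = i ∧ q j ω ≤ ρ j then
        ENNReal.ofReal (Real.exp 1) else 1 := fun j => by
      by_cases h1 : I j ω = i <;> simp [hg, hu, h1]
    simp_rw [this]
    rw [prod_ite_exp_eq _ _ fun _ => 1]
    refine ENNReal.ofReal_le_ofReal (Real.exp_le_exp.2 ?_)
    simpa using hω

end ModelBounds

/-! ### Geometry and mass of the cells -/

section Cells

variable {d : ℕ}

/-- The labels of the cubes of side `1 / K`. -/
def cells (d K : ℕ) : Finset (Fin d → ℕ) := Fintype.piFinset fun _ => Finset.range K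

theorem card_cells (d K : ℕ) : (cells d K).card = K ^ d := by simp [cells]

theorem cellIndex_one_div_apply (K : ℕ) (x : Fin d → ℝ) (k : Fin d) :
    cellIndex (1 / (K : ℝ)) x k = min ⌊x k * (K : ℝ)⌋₊ (K - 1) := by simp [cellIndex]

theorem cellIndex_mem_cells {K : ℕ} (hK : 0 < K) (x : Fin d → ℝ) :
    cellIndex (1 / (K : ℝ)) x ∈ cells d K := by
  simp only [cells, Fintype.mem_piFinset, Finset.mem_range, cellIndex_one_div_apply]
  intro k; omega

/-- The cube of side `h` with a given label. -/
def cell (h : ℝ) (c : Fin d → ℕ) : Set (Fin d → ℝ) := {x | cellIndex h x = c}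

theorem measurableSet_cell (h : ℝ) (c : Fin d → ℕ) : MeasurableSet (cell h c) := by
  have : Measurable fun x : Fin d → ℝ => cellIndex h x := by
    refine measurable_pi_lambda _ fun k => ?_
    have hk : Measurable fun x : Fin d → ℝ => x k := measurable_pi_apply k
    exact (Nat.measurable_floor.comp (hk.div_const h)).min measurable_const
  exact this (measurableSet_singleton c)

/-- The upper inequality is not strict because the last cell is closed at 1. -/
theorem cellIndex_le_and_le {K : ℕ} (hK : 0 < K) {x : Fin d → ℝ} (hx : x ∈ unitCube d) (k : Fin d) :
    (cellIndex (1 / (K : ℝ)) x k : ℝ) ≤ x k * K ∧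
      x k * K ≤ (cellIndex (1 / (K : ℝ)) x k : ℝ) + 1 := by
  have hK' : (0 : ℝ) < K := by exact_mod_cast hK
  have h0 : 0 ≤ x k := hx.1 k
  have h1 : x k ≤ 1 := hx.2 k
  rw [cellIndex_one_div_apply]
  have hfl := Nat.floor_le (mul_nonneg h0 hK'.le)
  have hlt := Nat.lt_floor_add_one (x k * (K : ℝ))
  rcases le_total ⌊x k * (K : ℝ)⌋₊ (K - 1) with hle | hle
  · rw [min_eq_left hle]; exact ⟨hfl, hlt.le⟩
  · rw [min_eq_right hle]
    refine ⟨le_trans (by exact_mod_cast hle) hfl, ?_⟩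
    rw [Nat.cast_sub hK]
    push_cast
    nlinarith

theorem dist_le_of_cellIndex_eq {K : ℕ} (hK : 0 < K) {x y : Fin d → ℝ} (hx : x ∈ unitCube d)
    (hy : y ∈ unitCube d) (hxy : cellIndex (1 / (K : ℝ)) x = cellIndex (1 / (K : ℝ)) y) :
    dist x y ≤ 1 / (K : ℝ) := by
  have hK' : (0 : ℝ) < K := by exact_mod_cast hK
  refine (dist_pi_le_iff (by positivity)).2 fun k => ?_
  have h1 := cellIndex_le_and_le hK hx k
  have h2 := cellIndex_le_and_le hK hy k
  rw [hxy] at h1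
  rw [Real.dist_eq, le_div_iff₀ hK', ← abs_of_pos hK', ← abs_mul, sub_mul]
  exact abs_le.2 ⟨by linarith [h1.1, h2.2], by linarith [h1.2, h2.1]⟩

theorem le_measureReal_cell {PX : Measure (Fin d → ℝ)} [IsFiniteMeasure PX]
    {p : (Fin d → ℝ) → ℝ} {cLow : ℝ}
    (hcLow : 0 ≤ cLow) (hp : ∀ x ∈ unitCube d, cLow ≤ p x)
    (hPX : PX = (volume.restrict (unitCube d)).withDensity fun x => ENNReal.ofReal (p x))
    {K : ℕ} (hK : 0 < K) {c : Fin d → ℕ} (hc : c ∈ cells d K) :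
    cLow * (1 / (K : ℝ)) ^ d ≤ PX.real (cell (1 / (K : ℝ)) c) := by
  have hK' : (0 : ℝ) < K := by exact_mod_cast hK
  simp only [cells, Fintype.mem_piFinset, Finset.mem_range] at hc
  set S := cell (1 / (K : ℝ)) c with hS
  set Q : Set (Fin d → ℝ) :=
    Set.pi Set.univ fun k => Set.Ico ((c k : ℝ) / K) (((c k : ℝ) + 1) / K) with hQ
  -- The floor and truncation let boundary cells extend outside the unit cube, so the density bound
  -- is applied on a half-open cube of side 1/K inside both.
  have hQsub : Q ⊆ S ∩ unitCube d := by
    intro x hx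
    have hx' : ∀ k, (c k : ℝ) ≤ x k * K ∧ x k * K < c k + 1 := fun k => by
      have := hx k (Set.mem_univ k)
      exact ⟨(div_le_iff₀ hK').1 this.1, (lt_div_iff₀ hK').1 this.2⟩
    have hck : ∀ k, (c k : ℝ) + 1 ≤ K := fun k => by exact_mod_cast hc k
    refine ⟨?_, fun k => ?_, fun k => ?_⟩
    · show cellIndex _ _ = _
      ext k
      rw [cellIndex_one_div_apply]
      have : ⌊x k * (K : ℝ)⌋₊ = c k := by
        rw [Nat.floor_eq_iff (le_trans (Nat.cast_nonneg _) (hx' k).1)]; exact hx' k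
      rw [this, min_eq_left]
      have := hc k; omega
    · have := (hx' k).1
      have h0 : (0 : ℝ) ≤ c k := Nat.cast_nonneg _
      by_contra hneg
      push Not at hneg
      simp only [Pi.zero_apply] at hneg
      nlinarith
    · have := (hx' k).2
      by_contra hneg
      push Not at hneg
      simp only [Pi.one_apply] at hneg
      nlinarith [hck k]
  have hvol : volume Q = ENNReal.ofReal ((1 / (K : ℝ)) ^ d) := by
    rw [hQ, Real.volume_pi_Ico]
    simp only [← sub_div, add_sub_cancel_left, Finset.prod_const, Finset.card_univ,
      Fintype.card_fin]
    rw [ENNReal.ofReal_pow (by positivity)]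
  have hcube : MeasurableSet (unitCube d) := measurableSet_Icc
  have hle : ENNReal.ofReal (cLow * (1 / (K : ℝ)) ^ d) ≤ PX S := by
    rw [hPX, withDensity_apply _ (measurableSet_cell _ c),
      Measure.restrict_restrict (measurableSet_cell _ c), ENNReal.ofReal_mul hcLow, ← hvol]
    calc ENNReal.ofReal cLow * volume Q ≤ ENNReal.ofReal cLow * volume (S ∩ unitCube d) := by
          gcongr
      _ = ∫⁻ _ in S ∩ unitCube d, ENNReal.ofReal cLow := by rw [setLIntegral_const]
      _ ≤ _ := setLIntegral_mono' ((measurableSet_cell _ c).inter hcube) fun x hx =>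
          ENNReal.ofReal_le_ofReal (hp x hx.2)
  rw [Measure.real]
  exact (ENNReal.ofReal_le_iff_le_toReal (measure_ne_top _ _)).1 hle

end Cells

/-! ### Consequences of the rate condition -/

section Rates

variable {d : ℕ} {h prob : ℕ → ℝ} {α β : ℝ}

theorem rpow_log_sub_one_mul {n : ℕ} (hn : 3 ≤ n) :
    (n : ℝ) ^ α * Real.log n ^ β = (n : ℝ) ^ α * Real.log n ^ (β - 1) * Real.log n := by
  have hn' : (3 : ℝ) ≤ n := by exact_mod_cast hn
  have hlog : 0 < Real.log n := Real.log_pos (by linarith)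
  rw [mul_assoc, ← Real.rpow_add_one hlog.ne', sub_add_cancel]

theorem one_le_log {n : ℕ} (hn : 3 ≤ n) : 1 ≤ Real.log n := by
  have hn' : (3 : ℝ) ≤ n := by exact_mod_cast hn
  rw [Real.le_log_iff_exp_le (by linarith)]
  linarith [Real.exp_one_lt_d9]

theorem rate_mul_log_le (hh : ∀ n, 1 ≤ n → 0 < h n ∧ h n ≤ 1)
    (hprob : ∀ n, 1 ≤ n → 0 < prob n ∧ prob n ≤ 1) {n : ℕ} (hn : 3 ≤ n) :
    (n : ℝ) ^ α * Real.log n ^ (β - 1) * h n ^ d * prob n ^ 2 * Real.log n ≤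
      (n : ℝ) ^ α * Real.log n ^ β * h n ^ d * prob n := by
  have hlog := one_le_log hn
  have hL : 0 ≤ (n : ℝ) ^ α * Real.log n ^ (β - 1) := by positivity
  obtain ⟨h0, -⟩ := hh n (by omega)
  obtain ⟨p0, p1⟩ := hprob n (by omega)
  rw [rpow_log_sub_one_mul (β := β) hn]
  have : prob n ^ 2 ≤ prob n := by nlinarith
  calc (n : ℝ) ^ α * Real.log n ^ (β - 1) * h n ^ d * prob n ^ 2 * Real.log n
      ≤ (n : ℝ) ^ α * Real.log n ^ (β - 1) * h n ^ d * prob n * Real.log n := by gcongr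
    _ = _ := by ring

theorem tendsto_rate_atTop (hh : ∀ n, 1 ≤ n → 0 < h n ∧ h n ≤ 1)
    (hprob : ∀ n, 1 ≤ n → 0 < prob n ∧ prob n ≤ 1)
    (hrate : Tendsto (fun n : ℕ => (n : ℝ) ^ α * Real.log n ^ (β - 1) * h n ^ d * prob n ^ 2)
      atTop atTop) :
    Tendsto (fun n : ℕ => (n : ℝ) ^ α * Real.log n ^ β * h n ^ d * prob n) atTop atTop := by
  refine tendsto_atTop_mono' _ ?_ hrate
  filter_upwards [eventually_ge_atTop 3, hrate.eventually_ge_atTop 0] with n hn h0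
  refine le_trans ?_ (rate_mul_log_le hh hprob hn)
  exact le_mul_of_one_le_right h0 (one_le_log hn)

theorem tendsto_delay_rate_atTop (hh : ∀ n, 1 ≤ n → 0 < h n ∧ h n ≤ 1)
    (hprob : ∀ n, 1 ≤ n → 0 < prob n ∧ prob n ≤ 1)
    (hrate : Tendsto (fun n : ℕ => (n : ℝ) ^ α * Real.log n ^ (β - 1) * h n ^ d * prob n ^ 2)
      atTop atTop) :
    Tendsto (fun n : ℕ => (n : ℝ) ^ α * Real.log n ^ β) atTop atTop := by
  refine tendsto_atTop_mono' _ ?_ (tendsto_rate_atTop hh hprob hrate)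
  filter_upwards [eventually_ge_atTop 3] with n hn
  have hlog := one_le_log hn
  obtain ⟨h0, h1⟩ := hh n (by omega)
  obtain ⟨p0, p1⟩ := hprob n (by omega)
  have hd : h n ^ d ≤ 1 := pow_le_one₀ h0.le h1
  rw [mul_assoc]
  exact mul_le_of_le_one_right (by positivity) (mul_le_one₀ hd p0.le p1)

/-- Makes the union bound over the h_n^{-d} cells summable. The rate being at least 1 bounds the
number of cells by n^(α + |β - 1|); the rate being large makes the exponent any prescribed multiple
of log n. -/
theorem eventually_inv_pow_mul_exp_le (hh : ∀ n, 1 ≤ n → 0 < h n ∧ h n ≤ 1)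
    (hprob : ∀ n, 1 ≤ n → 0 < prob n ∧ prob n ≤ 1)
    (hrate : Tendsto (fun n : ℕ => (n : ℝ) ^ α * Real.log n ^ (β - 1) * h n ^ d * prob n ^ 2)
      atTop atTop) {b : ℝ} (hb : 0 < b) :
    ∀ᶠ n : ℕ in atTop, (h n ^ d)⁻¹ *
      Real.exp (-(b * ((n : ℝ) ^ α * Real.log n ^ β * h n ^ d * prob n))) ≤ 1 / (n : ℝ) ^ 2 := by
  filter_upwards [eventually_ge_atTop 3, hrate.eventually_ge_atTop 1,
    hrate.eventually_ge_atTop ((2 + (α + |β - 1|)) / b)] with n hn h1 h2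
  have hn' : (3 : ℝ) ≤ n := by exact_mod_cast hn
  have hn0 : (0 : ℝ) < n := by linarith
  have hlog := one_le_log hn
  obtain ⟨hn0', -⟩ := hh n (by omega)
  obtain ⟨p0, p1⟩ := hprob n (by omega)
  have hhd : 0 < h n ^ d := by positivity
  have hL : 0 ≤ (n : ℝ) ^ α * Real.log n ^ (β - 1) := by positivity
  have hinv : (h n ^ d)⁻¹ ≤ (n : ℝ) ^ (α + |β - 1|) := by
    have hp2 : prob n ^ 2 ≤ 1 := pow_le_one₀ p0.le p1
    have hle : 1 ≤ (n : ℝ) ^ α * Real.log n ^ (β - 1) * h n ^ d :=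
      h1.trans (mul_le_of_le_one_right (by positivity) hp2)
    calc (h n ^ d)⁻¹ ≤ (n : ℝ) ^ α * Real.log n ^ (β - 1) := by
          rw [inv_le_iff_one_le_mul₀ hhd]; linarith
      _ ≤ (n : ℝ) ^ α * (n : ℝ) ^ |β - 1| := by
          gcongr
          calc Real.log n ^ (β - 1) ≤ Real.log n ^ |β - 1| :=
                Real.rpow_le_rpow_of_exponent_le hlog (le_abs_self _)
            _ ≤ (n : ℝ) ^ |β - 1| := Real.rpow_le_rpow (by linarith)
                (Real.log_le_self hn0.le) (abs_nonneg _)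
      _ = _ := (Real.rpow_add hn0 _ _).symm
  have hexp : Real.exp (-(b * ((n : ℝ) ^ α * Real.log n ^ β * h n ^ d * prob n))) ≤
      (n : ℝ) ^ (-(2 + (α + |β - 1|))) := by
    rw [Real.rpow_def_of_pos hn0 (-(2 + (α + |β - 1|))), Real.exp_le_exp]
    rw [div_le_iff₀' hb] at h2
    have h3 := mul_le_mul_of_nonneg_left
      (rate_mul_log_le (α := α) (β := β) (d := d) hh hprob hn) hb.le
    have h4 := mul_le_mul_of_nonneg_right h2 (by linarith : 0 ≤ Real.log n)
    linarith
  calc _ ≤ (n : ℝ) ^ (α + |β - 1|) * (n : ℝ) ^ (-(2 + (α + |β - 1|))) := by gcongr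
    _ = 1 / (n : ℝ) ^ 2 := by
      rw [← Real.rpow_add hn0, show α + |β - 1| + -(2 + (α + |β - 1|)) = -((2 : ℕ) : ℝ) by
        push_cast; ring, Real.rpow_neg hn0.le, Real.rpow_natCast, one_div]

end Rates

/-! ### Pathwise facts on observation times and held estimates -/

section Deterministic

variable {Ω : Type*} {ℓ d : ℕ} {X : ℕ → Ω → Fin d → ℝ} {ε : ℕ → Ω → Fin ℓ → ℝ}
  {D : ℕ → Ω → ℝ≥0∞} {I : ℕ → Ω → Fin ℓ} {f : Fin ℓ → (Fin d → ℝ) → ℝ} {h : ℕ → ℝ}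

theorem obsTime_le_iff {j n : ℕ} (hj : j ≤ n) (ω : Ω) :
    obsTime D j ω ≤ (n : ℝ≥0∞) ↔ D j ω ≤ ((n - j : ℕ) : ℝ≥0∞) := by
  rw [obsTime, ENNReal.natCast_sub, ENNReal.le_sub_iff_add_le_left (by simp) (by exact_mod_cast hj)]

open Classical in
theorem armTimes_eq (η : ℝ) (i : Fin ℓ) (n : ℕ) (ω : Ω) (x : Fin d → ℝ) :
    armTimes η X D I i n ω x = (Finset.Ioc 0 n).filter fun j =>
      I j ω = i ∧ X j ω ∈ cell η (cellIndex η x) ∧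
        D j ω ≤ ((n - j : ℕ) : ℝ≥0∞) := by
  refine Finset.filter_congr fun j hj => ?_
  rw [obsTime_le_iff (Finset.mem_Icc.1 hj).2]
  rfl

theorem InitDone.mono {m n : ℕ} (hmn : m ≤ n) {ω : Ω} (hm : InitDone D I m ω) :
    InitDone D I n ω := fun i => by
  obtain ⟨j, hj, hi, ho⟩ := hm i
  rw [Finset.mem_Icc] at hj
  exact ⟨j, Finset.mem_Icc.2 ⟨hj.1, hj.2.trans hmn⟩, hi, ho.trans (by exact_mod_cast hmn)⟩

/-- A held estimate is never older than the last arrival of a reward, so arbitrarily late arrivals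
transfer convergence from the histogram to the rule. -/
theorem exists_ruleEst_eq_histEst {i : Fin ℓ} {ω : Ω} {p : ℕ} (hp : NewReward D I i p ω) {n : ℕ}
    (hn : p + 1 ≤ n) : ∃ m, p + 1 ≤ m ∧
      ruleEst f h X ε D I i n ω = histEst f h X ε D I i m ω := by
  induction n, hn using Nat.le_induction with
  | base => exact ⟨p + 1, le_rfl, by ext x; simp [ruleEst, hp]⟩
  | succ n hn ih =>
    by_cases hc : InitDone D I n ω ∧ ¬ NewReward D I i n ω
    · obtain ⟨m, hm, he⟩ := ih
      exact ⟨m, hm, by ext x; rw [ruleEst, if_pos hc, he]⟩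
    · exact ⟨n + 1, by omega, by ext x; rw [ruleEst, if_neg hc]⟩

/-- Without arrivals after `P` the set of observed pulls of the arm would be frozen, against the
unbounded count in the cell of x. -/
theorem exists_newReward {i : Fin ℓ} {ω : Ω} {x : Fin d → ℝ} {b : ℕ → ℝ}
    (hb : Tendsto b atTop atTop)
    (hcard : ∀ᶠ n in atTop, b n ≤ ((armTimes (h n) X D I i n ω x).card : ℝ)) (P : ℕ) :
    ∃ p, P ≤ p ∧ NewReward D I i p ω := by
  classical
  by_contra! hno
  set O : ℕ → Finset ℕ := fun n => (Finset.Icc 1 n).filter fun j =>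
    I j ω = i ∧ obsTime D j ω ≤ (n : ℝ≥0∞) with hO
  have hsub : ∀ n, P ≤ n → O n ⊆ O P := by
    intro n hn
    induction n, hn using Nat.le_induction with
    | base => exact subset_rfl
    | succ n hn ih =>
      refine subset_trans (fun j hj => ?_) ih
      simp only [hO, Finset.mem_filter, Finset.mem_Icc] at hj ⊢
      have hle : obsTime D j ω ≤ (n : ℝ≥0∞) := by
        by_contra! hlt
        exact hno n hn ⟨j, Finset.mem_Icc.2 hj.1, hj.2.1, hlt, hj.2.2⟩
      refine ⟨⟨hj.1.1, ?_⟩, hj.2.1, hle⟩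
      have : (j : ℝ≥0∞) ≤ n := le_trans le_self_add hle
      exact_mod_cast this
  obtain ⟨n, hn1, hn2, hn3⟩ := (hcard.and ((eventually_ge_atTop P).and
    (hb.eventually_gt_atTop ((O P).card : ℝ)))).exists
  have hle : (armTimes (h n) X D I i n ω x).card ≤ (O P).card := by
    refine Finset.card_le_card (subset_trans (fun j hj => ?_) (hsub n hn2))
    simp only [armTimes, hO, Finset.mem_filter] at hj ⊢
    exact ⟨hj.1, hj.2.1, hj.2.2.2⟩
  have : ((armTimes (h n) X D I i n ω x).card : ℝ) ≤ (O P).card := by exact_mod_cast hle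
  linarith

end Deterministic

/-! ### Almost sure statements by Borel–Cantelli -/

section AlmostSure

variable {Ω : Type*} {ℓ d : ℕ} [mΩ : MeasurableSpace Ω] {μ : Measure Ω} {PX : Measure (Fin d → ℝ)}
  {X : ℕ → Ω → Fin d → ℝ} {ε : ℕ → Ω → Fin ℓ → ℝ} {D : ℕ → Ω → ℝ≥0∞} {I : ℕ → Ω → Fin ℓ}
  {f : Fin ℓ → (Fin d → ℝ) → ℝ} {h prob : ℕ → ℝ} {a : ℕ → Fin ℓ} {sel : (Fin ℓ → ℝ) → Fin ℓ}
  {α β : ℝ}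

theorem pos_and_le_one_of_bandwidth (hh : ∀ n, 1 ≤ n → ∃ K : ℕ, 0 < K ∧ h n = 1 / (K : ℝ)) (n : ℕ)
    (hn : 1 ≤ n) : 0 < h n ∧ h n ≤ 1 := by
  obtain ⟨K, hK, he⟩ := hh n hn
  have hK' : (1 : ℝ) ≤ K := by exact_mod_cast hK
  rw [he]
  exact ⟨by positivity, by rw [div_le_one (by linarith)]; exact hK'⟩

/-- Once the exploration probabilities are small and the initialization is done, every arm is pulled
with conditional probability at least the exploration probability. -/
theorem ae_le_armProb (hrule : FollowsRule μ f h prob a sel X ε D I) {M : ℕ}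
    (hM : ∀ n, M ≤ n → (ℓ : ℝ) * prob n ≤ 1) (i : Fin ℓ) :
    ∀ᵐ ω ∂μ, InitDone D I M ω → ∀ j, M < j → prob j ≤ armProb μ X ε D I i j ω := by
  filter_upwards [ae_all_iff.2 fun n => hrule.randomized n i] with ω hω hinit j hj
  obtain ⟨n, rfl⟩ : ∃ n, j = n + 1 := ⟨j - 1, by omega⟩
  have h1 := hω n (hinit.mono (by omega))
  rw [armProb, h1]
  split_ifs
  · linarith [hM (n + 1) (by omega)]
  · exact le_rfl

/-- A suboptimal selection is an exploration pull. -/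
theorem ae_armProb_le_of_ne (hrule : FollowsRule μ f h prob a sel X ε D I) :
    ∀ᵐ ω ∂μ, ∀ n, InitDone D I n ω →
      I (n + 1) ω ≠ sel (fun k => ruleEst f h X ε D I k n ω (X (n + 1) ω)) →
      armProb μ X ε D I (I (n + 1) ω) (n + 1) ω ≤ prob (n + 1) := by
  filter_upwards [ae_all_iff.2 fun n => ae_all_iff.2 fun i => hrule.randomized n i]
    with ω hω n hinit hne
  have h1 := hω n (I (n + 1) ω) hinit
  rw [if_neg hne] at h1
  rw [armProb, h1]

theorem delayCDF_le_one [IsProbabilityMeasure μ] (j : ℕ) (s : ℝ≥0∞) : delayCDF μ D j s ≤ 1 :=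
  measureReal_le_one

/-- Dropping the first `M` pulls costs at most `M`, which half of the growing bound absorbs. -/
theorem eventually_le_sum_delayCDF [IsProbabilityMeasure μ] {L : ℕ → ℝ} {c : ℝ} (hc : 0 < c)
    (hL : Tendsto L atTop atTop)
    (hdelay : ∀ᶠ n : ℕ in atTop, c * L n ≤
      ∑ j ∈ Finset.Icc 1 n, delayCDF μ D j ((n - j : ℕ) : ℝ≥0∞)) (M : ℕ) :
    ∀ᶠ n : ℕ in atTop, c / 2 * L n ≤
      ∑ j ∈ Finset.Ioc M n, delayCDF μ D j ((n - j : ℕ) : ℝ≥0∞) := by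
  filter_upwards [hdelay, eventually_ge_atTop M, hL.eventually_ge_atTop (2 * M / c)]
    with n hn hM hLn
  have hsplit : ∑ j ∈ Finset.Icc 1 n, delayCDF μ D j ((n - j : ℕ) : ℝ≥0∞) =
      ∑ j ∈ Finset.Ioc 0 M, delayCDF μ D j ((n - j : ℕ) : ℝ≥0∞) +
      ∑ j ∈ Finset.Ioc M n, delayCDF μ D j ((n - j : ℕ) : ℝ≥0∞) :=
    (Finset.sum_Ioc_consecutive _ (Nat.zero_le M) hM).symm
  have hle : ∑ j ∈ Finset.Ioc 0 M, delayCDF μ D j ((n - j : ℕ) : ℝ≥0∞) ≤ M := by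
    refine (Finset.sum_le_card_nsmul _ _ 1 fun j _ => delayCDF_le_one j _).trans_eq ?_
    simp
  rw [div_le_iff₀ hc] at hLn
  linarith

theorem isProbabilityMeasure_design [IsProbabilityMeasure μ] (hmodel : IsModel μ PX X ε D I) :
    IsProbabilityMeasure PX := by
  rw [← hmodel.covariate_law 1 le_rfl]
  exact Measure.isProbabilityMeasure_map (hmodel.measurable_covariate 1 le_rfl).aemeasurable

theorem measure_biUnion_cells_le {n : ℕ} (hh : ∃ K : ℕ, 0 < K ∧ h n = 1 / (K : ℝ))
    (E : (Fin d → ℕ) → Set Ω) {r C : ℝ}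
    (hE : ∀ K : ℕ, h n = 1 / (K : ℝ) → 0 < K → ∀ c ∈ cells d K, μ (E c) ≤ ENNReal.ofReal r)
    (hr : (h n ^ d)⁻¹ * r ≤ C) :
    μ {ω | ∃ x ∈ unitCube d, ω ∈ E (cellIndex (h n) x)} ≤ ENNReal.ofReal C := by
  obtain ⟨K, hK, he⟩ := hh
  have hK' : (0 : ℝ) < K := by exact_mod_cast hK
  calc μ {ω | ∃ x ∈ unitCube d, ω ∈ E (cellIndex (h n) x)}
      ≤ μ (⋃ c ∈ cells d K, E c) := measure_mono fun ω ⟨x, _, hω⟩ =>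
        Set.mem_biUnion (he ▸ cellIndex_mem_cells hK x) hω
    _ ≤ ∑ c ∈ cells d K, μ (E c) := measure_biUnion_finset_le _ _
    _ ≤ ∑ _c ∈ cells d K, ENNReal.ofReal r := Finset.sum_le_sum fun c hc => hE K he hK c hc
    _ = ENNReal.ofReal ((h n ^ d)⁻¹ * r) := by
        rw [Finset.sum_const, card_cells, nsmul_eq_mul, he, ENNReal.ofReal_mul (by positivity)]
        congr 1
        rw [one_div, inv_pow, inv_inv, ENNReal.ofReal_pow hK'.le]
        simp
    _ ≤ _ := ENNReal.ofReal_le_ofReal hr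

theorem summable_const_div_sq (C : ℝ) : Summable fun n : ℕ => C * (1 / (n : ℝ) ^ 2) :=
  (Real.summable_one_div_nat_pow.2 one_lt_two).mul_left C

/-- Every arm is observed in every cell at least at the rate `n^α (log n)^β h_n^d π_n`. -/
theorem ae_eventually_le_card_armTimes [IsProbabilityMeasure μ]
    (hh : ∀ n, 1 ≤ n → ∃ K : ℕ, 0 < K ∧ h n = 1 / (K : ℝ))
    (hprob : ∀ n, 1 ≤ n → 0 < prob n ∧ prob n ≤ 1)
    (hprob_anti : ∀ m n, 1 ≤ m → m ≤ n → prob n ≤ prob m)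
    (hprob_lim : Tendsto prob atTop (𝓝 0))
    (hmodel : IsModel μ PX X ε D I) (hrule : FollowsRule μ f h prob a sel X ε D I)
    (hinit : ∀ᵐ ω ∂μ, ∃ n, InitDone D I n ω) (hdesign : DesignCondition PX)
    (hdelay : DelayCondition μ D α β)
    (hrate : Tendsto (fun n : ℕ => (n : ℝ) ^ α * Real.log n ^ (β - 1) * h n ^ d * prob n ^ 2)
      atTop atTop) :
    ∃ b : ℝ, 0 < b ∧ ∀ i, ∀ᵐ ω ∂μ, ∀ᶠ n : ℕ in atTop, ∀ x ∈ unitCube d,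
      b * ((n : ℝ) ^ α * Real.log n ^ β * h n ^ d * prob n) ≤
        ((armTimes (h n) X D I i n ω x).card : ℝ) := by
  classical
  obtain ⟨p, cLow, cUp, -, hcLow, hp, hPX⟩ := hdesign
  obtain ⟨c, hc, hdelay⟩ := hdelay
  have hPXprob := isProbabilityMeasure_design hmodel
  have hh' := pos_and_le_one_of_bandwidth hh
  set B : ℕ → ℝ := fun n => (n : ℝ) ^ α * Real.log n ^ β * h n ^ d * prob n with hB
  -- The Chernoff exponent is π/2 times cLow h^d times c/2 times the delay rate, which is 2 b B_n;
  -- subtracting the threshold b B_n leaves b B_n.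
  set b : ℝ := cLow * c / 8 with hb
  have hb0 : 0 < b := by positivity
  refine ⟨b, hb0, fun i => ?_⟩
  obtain ⟨M₀, hM₀⟩ : ∃ M₀, ∀ n, M₀ ≤ n → (ℓ : ℝ) * prob n ≤ 1 := by
    have : Tendsto (fun n => (ℓ : ℝ) * prob n) atTop (𝓝 0) := by
      simpa using hprob_lim.const_mul (ℓ : ℝ)
    exact eventually_atTop.1 (this.eventually_le_const one_pos)
  let s : ℕ → ℕ → ℝ≥0∞ := fun n j => ((n - j : ℕ) : ℝ≥0∞)
  let E : ℕ → ℕ → (Fin d → ℕ) → Set Ω := fun M n κ => {ω |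
    (((Finset.Ioc M n).filter fun j => (X j ω ∈ cell (h n) κ ∧ D j ω ≤ s n j) ∧
      (I j ω = i ∨ armProb μ X ε D I i j ω < prob n)).card : ℝ) ≤ b * B n}
  have hev : ∀ M, ∀ᵐ ω ∂μ, ∀ᶠ n in atTop,
      ω ∉ {ω | ∃ x ∈ unitCube d, ω ∈ E M n (cellIndex (h n) x)} := by
    intro M
    refine ae_eventually_notMem_of_eventually_le (summable_const_div_sq 1) ?_
    filter_upwards [
      eventually_le_sum_delayCDF hc (tendsto_delay_rate_atTop hh' hprob hrate) hdelay M,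
      eventually_inv_pow_mul_exp_le hh' hprob hrate hb0, eventually_ge_atTop M,
      eventually_ge_atTop 1] with n hG hexp hMn hn1
    refine measure_biUnion_cells_le (hh n hn1) (E M n) (r := Real.exp (-(b * B n)))
      (fun K he hK κ hκ => ?_) (by simpa [hB] using hexp)
    obtain ⟨p0, p1⟩ := hprob n hn1
    refine (measure_observed_pulls_le hmodel (measurableSet_cell (h n) κ) (s n) i p1 hMn
      (b * B n)).trans (ENNReal.ofReal_le_ofReal (Real.exp_le_exp.2 ?_))
    have hcell := le_measureReal_cell hcLow.le (fun x hx => (hp x hx).1) hPX hK hκ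
    rw [← he] at hcell
    have h0 := (hh' n hn1).1
    have hG0 : 0 ≤ ∑ j ∈ Finset.Ioc M n, delayCDF μ D j (s n j) :=
      Finset.sum_nonneg fun j _ => measureReal_nonneg
    have h1 : cLow * h n ^ d * (c / 2 * ((n : ℝ) ^ α * Real.log n ^ β)) ≤
        PX.real (cell (h n) κ) * ∑ j ∈ Finset.Ioc M n, delayCDF μ D j (s n j) :=
      (mul_le_mul_of_nonneg_left hG (by positivity)).trans (mul_le_mul_of_nonneg_right hcell hG0)
    have h2 := mul_le_mul_of_nonneg_left h1 (by positivity : 0 ≤ prob n / 2)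
    have h3 : prob n / 2 * (cLow * h n ^ d * (c / 2 * ((n : ℝ) ^ α * Real.log n ^ β))) =
        2 * (b * B n) := by simp only [hb, hB]; ring
    linarith
  -- The end of the initialization is random, but the bounds hold almost surely for all integers `M`
  -- at once, so its value at ω may be inserted.
  filter_upwards [hinit, ae_all_iff.2 hev, ae_all_iff.2 fun M => ae_le_armProb hrule
    (M := max M M₀) (fun n hn => hM₀ n (le_of_max_le_right hn)) i] with ω ⟨M, hM⟩ hω hq
  filter_upwards [hω (max M M₀), eventually_ge_atTop 1] with n hn hn1 x hx
  have hlt : ω ∉ E (max M M₀) n (cellIndex (h n) x) := fun hmem => hn ⟨x, hx, hmem⟩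
  simp only [E, Set.mem_ofPred_eq, not_le] at hlt
  refine hlt.le.trans ?_
  rw [armTimes_eq]
  refine Nat.cast_le.2 (Finset.card_le_card fun j hj => ?_)
  simp only [Finset.mem_filter, Finset.mem_Ioc] at hj ⊢
  obtain ⟨⟨hj1, hj2⟩, ⟨hj3, hj4⟩, hj5⟩ := hj
  have hqj := hq M (hM.mono (le_max_left _ _)) j hj1
  have := hprob_anti j n (by omega) hj2
  exact ⟨⟨by omega, hj2⟩, hj5.resolve_right (by linarith), hj3, hj4⟩

theorem ae_eventually_error_sum_le [IsProbabilityMeasure μ]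
    (hh : ∀ n, 1 ≤ n → ∃ K : ℕ, 0 < K ∧ h n = 1 / (K : ℝ))
    (hprob : ∀ n, 1 ≤ n → 0 < prob n ∧ prob n ≤ 1)
    (hmodel : IsModel μ PX X ε D I) (hbern : BernsteinCondition μ ε)
    (hrate : Tendsto (fun n : ℕ => (n : ℝ) ^ α * Real.log n ^ (β - 1) * h n ^ d * prob n ^ 2)
      atTop atTop) {b δ : ℝ} (hb : 0 < b) (hδ : 0 < δ) (i : Fin ℓ) :
    ∀ᵐ ω ∂μ, ∀ᶠ n : ℕ in atTop, ∀ x ∈ unitCube d,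
      b * ((n : ℝ) ^ α * Real.log n ^ β * h n ^ d * prob n) ≤
        ((armTimes (h n) X D I i n ω x).card : ℝ) →
      |∑ j ∈ armTimes (h n) X D I i n ω x, ε j ω i| ≤
        δ * ((armTimes (h n) X D I i n ω x).card : ℝ) := by
  classical
  obtain ⟨v, c, hv, hc, hbern⟩ := hbern
  have hh' := pos_and_le_one_of_bandwidth hh
  set B : ℕ → ℝ := fun n => (n : ℝ) ^ α * Real.log n ^ β * h n ^ d * prob n with hB
  -- With this t the compensator t²v² per observation uses at most half of the gain tδ, leaving tδ/2
  -- times the count.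
  obtain ⟨t, ht0, htc, htδ⟩ : ∃ t : ℝ, 0 < t ∧ t * c ≤ 1 / 2 ∧ t * v ^ 2 ≤ δ / 2 := by
    refine ⟨min (1 / (2 * c)) (δ / (2 * v ^ 2)), lt_min (by positivity) (by positivity), ?_, ?_⟩
    · calc _ ≤ 1 / (2 * c) * c := by gcongr; exact min_le_left _ _
        _ = 1 / 2 := by field_simp
    · calc _ ≤ δ / (2 * v ^ 2) * v ^ 2 := by gcongr; exact min_le_right _ _
        _ = δ / 2 := by field_simp
  let s : ℕ → ℕ → ℝ≥0∞ := fun n j => ((n - j : ℕ) : ℝ≥0∞)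
  let T : ℕ → (Fin d → ℕ) → Ω → Finset ℕ := fun n κ ω => (Finset.Ioc 0 n).filter fun j =>
    I j ω = i ∧ X j ω ∈ cell (h n) κ ∧ D j ω ≤ s n j
  let E : ℕ → (Fin d → ℕ) → Set Ω := fun n κ => {ω |
    b * B n ≤ ((T n κ ω).card : ℝ) ∧ δ * ((T n κ ω).card : ℝ) < |∑ j ∈ T n κ ω, ε j ω i|}
  have hev : ∀ᵐ ω ∂μ, ∀ᶠ n in atTop,
      ω ∉ {ω | ∃ x ∈ unitCube d, ω ∈ E n (cellIndex (h n) x)} := by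
    refine ae_eventually_notMem_of_eventually_le (summable_const_div_sq 2) ?_
    filter_upwards [eventually_inv_pow_mul_exp_le hh' hprob hrate (b := t * δ / 2 * b)
      (by positivity), eventually_ge_atTop 1] with n hexp hn1
    refine measure_biUnion_cells_le (hh n hn1) (E n)
      (r := 2 * Real.exp (-(t * δ / 2 * b * B n))) (fun K he hK κ hκ => ?_) (by linarith)
    have hside : ∀ t' : ℝ, |t'| = t → μ {ω | t * δ / 2 * b * B n ≤
        ∑ j ∈ T n κ ω, (t' * ε j ω i - t' ^ 2 * v ^ 2)} ≤
        ENNReal.ofReal (Real.exp (-(t * δ / 2 * b * B n))) := fun t' ht' =>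
      measure_error_sum_ge_le hmodel hc hbern (measurableSet_cell (h n) κ) (s n) i n
        (by rwa [ht']) _
    have hsub : E n κ ⊆ {ω | t * δ / 2 * b * B n ≤ ∑ j ∈ T n κ ω, (t * ε j ω i - t ^ 2 * v ^ 2)} ∪
        {ω | t * δ / 2 * b * B n ≤ ∑ j ∈ T n κ ω, (-t * ε j ω i - (-t) ^ 2 * v ^ 2)} := by
      rintro ω ⟨h1, h2⟩
      simp only [Set.mem_union, Set.mem_ofPred_eq, Finset.sum_sub_distrib, ← Finset.mul_sum,
        Finset.sum_const, nsmul_eq_mul]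
      set N : ℝ := ((T n κ ω).card : ℝ)
      set S : ℝ := ∑ j ∈ T n κ ω, ε j ω i
      have hN : 0 ≤ N := Nat.cast_nonneg _
      have e1 : t * v ^ 2 * (t * N) ≤ δ / 2 * (t * N) := by gcongr
      have e2 : t * δ / 2 * (b * B n) ≤ t * δ / 2 * N := by gcongr
      rcases lt_abs.1 h2 with h3 | h3
      · left
        have e3 := mul_lt_mul_of_pos_left h3 ht0
        nlinarith
      · right
        have e3 := mul_lt_mul_of_pos_left h3 ht0
        nlinarith
    refine (measure_mono hsub).trans ((measure_union_le _ _).trans ?_)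
    refine (add_le_add (hside t (abs_of_pos ht0))
      (hside (-t) (by rw [abs_neg, abs_of_pos ht0]))).trans_eq ?_
    rw [← ENNReal.ofReal_add (Real.exp_pos _).le (Real.exp_pos _).le, two_mul]
  filter_upwards [hev] with ω hω
  filter_upwards [hω] with n hn x hx
  rw [armTimes_eq]
  intro hcard
  by_contra! hlt
  exact hn ⟨x, hx, hcard, hlt⟩

theorem tendsto_sum_Ioc_div {u : ℕ → ℝ} {l : ℝ} (hu : Tendsto u atTop (𝓝 l)) :
    Tendsto (fun n : ℕ => (∑ j ∈ Finset.Ioc 0 n, u j) / n) atTop (𝓝 l) := by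
  have h1 := ((tendsto_add_atTop_iff_nat 1).2 hu).cesaro
  refine h1.congr fun n => ?_
  rw [Finset.range_eq_Ico, Finset.sum_Ico_add', inv_mul_eq_div]
  congr 2

open Classical in
theorem ae_eventually_improbable_pulls_le [IsProbabilityMeasure μ]
    (hprob : ∀ n, 1 ≤ n → 0 < prob n ∧ prob n ≤ 1) (hprob_lim : Tendsto prob atTop (𝓝 0))
    (hmodel : IsModel μ PX X ε D I) {δ : ℝ} (hδ : 0 < δ) (i : Fin ℓ) :
    ∀ᵐ ω ∂μ, ∀ᶠ n : ℕ in atTop, (((Finset.Ioc 0 n).filter fun j =>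
        I j ω = i ∧ armProb μ X ε D I i j ω ≤ prob j).card : ℝ) ≤ δ * n := by
  have hsum : Summable fun n : ℕ => Real.exp (n * (-(δ / 2))) :=
    Real.summable_exp_nat_mul_iff.2 (by linarith)
  have hev := ae_eventually_notMem_of_eventually_le (μ := μ) hsum (s := fun n : ℕ =>
    {ω | δ * n ≤ (((Finset.Ioc 0 n).filter fun j =>
        I j ω = i ∧ armProb μ X ε D I i j ω ≤ prob j).card : ℝ)}) ?_
  · filter_upwards [hev] with ω hω
    filter_upwards [hω] with n hn
    exact (not_le.1 hn).le
  · filter_upwards [(tendsto_sum_Ioc_div hprob_lim).eventually_le_const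
      (show (0 : ℝ) < δ / 4 by linarith), eventually_ge_atTop 1] with n hn hn1
    refine (measure_improbable_pulls_ge_le hmodel i prob (fun j hj => (hprob j hj).1.le) n
      (δ * n)).trans (ENNReal.ofReal_le_ofReal (Real.exp_le_exp.2 ?_))
    have hn' : (0 : ℝ) < n := by exact_mod_cast hn1
    rw [div_le_iff₀ hn'] at hn
    linarith

end AlmostSure

/-! ### From uniform convergence to the reward ratio, pathwise -/

section Consistency

variable {Ω : Type*} {ℓ d : ℕ} {X : ℕ → Ω → Fin d → ℝ} {ε : ℕ → Ω → Fin ℓ → ℝ}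
  {D : ℕ → Ω → ℝ≥0∞} {I : ℕ → Ω → Fin ℓ} {f : Fin ℓ → (Fin d → ℝ) → ℝ} {h : ℕ → ℝ}

theorem le_fStar (f : Fin ℓ → (Fin d → ℝ) → ℝ) (i : Fin ℓ) (x : Fin d → ℝ) : f i x ≤ fStar f x :=
  le_ciSup (f := fun i => f i x) (Set.finite_range _).bddAbove i

/-- The histogram estimator is uniformly consistent as soon as the error averages are uniformly
small and every cell is occupied. -/
theorem tendstoUniformlyOn_histEst (hh : ∀ n, 1 ≤ n → ∃ K : ℕ, 0 < K ∧ h n = 1 / (K : ℝ))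
    (hh_lim : Tendsto h atTop (𝓝 0)) {ω : Ω} (hX : ∀ j, 1 ≤ j → X j ω ∈ unitCube d) {i : Fin ℓ}
    (hf : ContinuousOn (f i) (unitCube d))
    (hcard : ∀ᶠ n in atTop, ∀ x ∈ unitCube d, 0 < (armTimes (h n) X D I i n ω x).card)
    (herr : ∀ δ : ℝ, 0 < δ → ∀ᶠ n in atTop, ∀ x ∈ unitCube d,
      |∑ j ∈ armTimes (h n) X D I i n ω x, ε j ω i| ≤
        δ * ((armTimes (h n) X D I i n ω x).card : ℝ)) :
    TendstoUniformlyOn (fun (n : ℕ) x => histEst f h X ε D I i n ω x) (f i) atTop (unitCube d) := by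
  rw [Metric.tendstoUniformlyOn_iff]
  intro η hη
  have huc : UniformContinuousOn (f i) (unitCube d) :=
    isCompact_Icc.uniformContinuousOn_of_continuous hf
  obtain ⟨r, hr, hfr⟩ := Metric.uniformContinuousOn_iff.1 huc (η / 3) (by positivity)
  filter_upwards [hcard, herr (η / 3) (by positivity), hh_lim.eventually_lt_const hr,
    eventually_ge_atTop 1] with n hn he hhr hn1 x hx
  obtain ⟨K, hK, hhK⟩ := hh n hn1
  set T := armTimes (h n) X D I i n ω x with hT
  have hN : (0 : ℝ) < T.card := by exact_mod_cast hn x hx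
  have hbias : |∑ j ∈ T, (f i (X j ω) - f i x)| ≤ η / 3 * T.card := by
    refine (Finset.abs_sum_le_sum_abs _ _).trans ?_
    refine (Finset.sum_le_card_nsmul _ _ (η / 3) fun j hj => ?_).trans_eq ?_
    · simp only [hT, armTimes, Finset.mem_filter, Finset.mem_Icc] at hj
      have hXj := hX j hj.1.1
      have hdist : dist (X j ω) x < r := by
        refine lt_of_le_of_lt ?_ hhr
        rw [hhK]
        exact dist_le_of_cellIndex_eq hK hXj hx (hhK ▸ hj.2.2.1)
      exact (hfr _ hXj _ hx hdist).le
    · rw [nsmul_eq_mul, mul_comm]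
  have hdecomp : histEst f h X ε D I i n ω x - f i x =
      (∑ j ∈ T, (f i (X j ω) - f i x) + ∑ j ∈ T, ε j ω i) / T.card := by
    rw [histEst, ← hT, eq_div_iff hN.ne', sub_mul, div_mul_cancel₀ _ hN.ne',
      Finset.sum_sub_distrib, Finset.sum_const, nsmul_eq_mul]
    simp only [reward, Finset.sum_add_distrib]
    ring
  rw [dist_comm, Real.dist_eq, hdecomp, abs_div, abs_of_pos hN, div_lt_iff₀ hN]
  have := abs_add_le (∑ j ∈ T, (f i (X j ω) - f i x)) (∑ j ∈ T, ε j ω i)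
  have := he x hx
  nlinarith

theorem tendstoUniformlyOn_ruleEst {i : Fin ℓ} {ω : Ω}
    (hhist : TendstoUniformlyOn (fun (n : ℕ) x => histEst f h X ε D I i n ω x) (f i) atTop
      (unitCube d))
    (hnew : ∀ P, ∃ p, P ≤ p ∧ NewReward D I i p ω) :
    TendstoUniformlyOn (fun (n : ℕ) x => ruleEst f h X ε D I i n ω x) (f i) atTop (unitCube d) := by
  rw [Metric.tendstoUniformlyOn_iff] at hhist ⊢
  intro η hη
  obtain ⟨P, hP⟩ := eventually_atTop.1 (hhist η hη)
  obtain ⟨p, hp, hnewp⟩ := hnew P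
  filter_upwards [eventually_ge_atTop (p + 1)] with n hn x hx
  obtain ⟨m, hm, he⟩ := exists_ruleEst_eq_histEst (f := f) (h := h) (X := X) (ε := ε) hnewp hn
  rw [he]
  exact hP m (by omega) x hx

theorem fStar_le_of_maximizer (hℓ : 0 < ℓ) {sel : (Fin ℓ → ℝ) → Fin ℓ}
    (hsel : ∀ (v : Fin ℓ → ℝ) (i : Fin ℓ), v i ≤ v (sel v)) {v : Fin ℓ → ℝ} {x : Fin d → ℝ} {η : ℝ}
    (hv : ∀ k, |f k x - v k| ≤ η) : fStar f x ≤ f (sel v) x + 2 * η := by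
  have : Nonempty (Fin ℓ) := ⟨⟨0, hℓ⟩⟩
  refine ciSup_le fun k => ?_
  have h1 := (abs_le.1 (hv k)).2
  have h2 := (abs_le.1 (hv (sel v))).1
  linarith [hsel v k]

theorem tendsto_rewardRatio {ω : Ω} {m : ℝ} (hm : 0 < m)
    (hmean : Tendsto (fun n : ℕ => (∑ j ∈ Finset.Ioc 0 n, fStar f (X j ω)) / n) atTop (𝓝 m))
    (hregret : ∀ η : ℝ, 0 < η → ∀ᶠ n : ℕ in atTop,
      ∑ j ∈ Finset.Ioc 0 n, (fStar f (X j ω) - f (I j ω) (X j ω)) ≤ η * n) :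
    Tendsto (fun n => rewardRatio f X I n ω) atTop (𝓝 1) := by
  have hzero : Tendsto (fun n : ℕ =>
      (∑ j ∈ Finset.Ioc 0 n, (fStar f (X j ω) - f (I j ω) (X j ω))) / n) atTop (𝓝 0) := by
    rw [Metric.tendsto_nhds]
    intro η hη
    filter_upwards [hregret (η / 2) (by positivity), eventually_ge_atTop 1] with n hn hn1
    have hn' : (0 : ℝ) < n := by exact_mod_cast hn1
    have h0 : 0 ≤ ∑ j ∈ Finset.Ioc 0 n, (fStar f (X j ω) - f (I j ω) (X j ω)) :=
      Finset.sum_nonneg fun j _ => sub_nonneg.2 (le_fStar f _ _)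
    rw [Real.dist_eq, sub_zero, abs_of_nonneg (by positivity), div_lt_iff₀ hn']
    nlinarith
  have hlim := (hzero.div hmean hm.ne').const_sub 1
  rw [zero_div, sub_zero] at hlim
  refine hlim.congr' ?_
  filter_upwards [hmean.eventually_const_lt hm, eventually_ge_atTop 1] with n hn hn1
  have hn' : (0 : ℝ) < n := by exact_mod_cast hn1
  have hS : 0 < ∑ j ∈ Finset.Ioc 0 n, fStar f (X j ω) := by
    by_contra! hle
    exact absurd hn (not_lt.2 (div_nonpos_of_nonpos_of_nonneg hle hn'.le))
  have e1 : rewardRatio f X I n ω = (∑ j ∈ Finset.Ioc 0 n, f (I j ω) (X j ω)) /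
      ∑ j ∈ Finset.Ioc 0 n, fStar f (X j ω) := rfl
  simp only [Pi.div_apply]
  rw [e1, div_div_div_cancel_right₀ hn'.ne', Finset.sum_sub_distrib, sub_div, div_self hS.ne']
  ring

-- Beyond a fixed time `J`, a greedy pull loses at most twice the estimation error and any other
-- pull is `bad`. Losses are bounded by `A'`, so the first `J` pulls and the rare bad ones cost
-- little per unit of time; each of the three parts gets η/3.
open Classical in
theorem eventually_regret_le (hℓ : 0 < ℓ) {sel : (Fin ℓ → ℝ) → Fin ℓ}
    (hsel : ∀ (v : Fin ℓ → ℝ) (i : Fin ℓ), v i ≤ v (sel v)) {ω : Ω}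
    (hX : ∀ j, 1 ≤ j → X j ω ∈ unitCube d) {A : ℝ}
    (hA : ∀ i, ∀ x ∈ unitCube d, fStar f x - f i x ≤ A)
    (hunif : ∀ i, TendstoUniformlyOn (fun (n : ℕ) x => ruleEst f h X ε D I i n ω x) (f i)
      atTop (unitCube d))
    (bad : Fin ℓ → ℕ → Prop) {M : ℕ}
    (hbad : ∀ n, M ≤ n → I (n + 1) ω ≠ sel (fun k => ruleEst f h X ε D I k n ω (X (n + 1) ω)) →
      bad (I (n + 1) ω) (n + 1))
    (hfew : ∀ δ : ℝ, 0 < δ → ∀ i, ∀ᶠ n : ℕ in atTop,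
      (((Finset.Ioc 0 n).filter fun j => I j ω = i ∧ bad i j).card : ℝ) ≤ δ * n)
    {η : ℝ} (hη : 0 < η) :
    ∀ᶠ n : ℕ in atTop,
      ∑ j ∈ Finset.Ioc 0 n, (fStar f (X j ω) - f (I j ω) (X j ω)) ≤ η * n := by
  have hℓ' : (0 : ℝ) < ℓ := by exact_mod_cast hℓ
  set A' : ℝ := max A 1 with hA'
  have hA0 : 0 < A' := lt_of_lt_of_le one_pos (le_max_right _ _)
  obtain ⟨N, hN⟩ := eventually_atTop.1 (eventually_all.2 fun i =>
    (Metric.tendstoUniformlyOn_iff.1 (hunif i)) (η / 6) (by positivity))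
  set J := max M N with hJ
  have hpoint : ∀ j, 1 ≤ j → fStar f (X j ω) - f (I j ω) (X j ω) ≤
      η / 3 + A' * (if j ≤ J then 1 else 0) +
        A' * ∑ i, (if I j ω = i ∧ bad i j then (1 : ℝ) else 0) := by
    intro j hj
    have hgap : fStar f (X j ω) - f (I j ω) (X j ω) ≤ A' :=
      (hA _ _ (hX j hj)).trans (le_max_left _ _)
    have hnn : ∀ i ∈ Finset.univ, (0 : ℝ) ≤ if I j ω = i ∧ bad i j then (1 : ℝ) else 0 :=
      fun i _ => by split_ifs <;> norm_num
    have hsum := mul_nonneg hA0.le (Finset.sum_nonneg hnn)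
    by_cases hjJ : j ≤ J
    · rw [if_pos hjJ]; linarith
    rw [if_neg hjJ, mul_zero, add_zero]
    obtain ⟨n, rfl⟩ : ∃ n, j = n + 1 := ⟨j - 1, by omega⟩
    have hMn : M ≤ n := by omega
    have hNn : N ≤ n := by omega
    by_cases hI : I (n + 1) ω = sel (fun k => ruleEst f h X ε D I k n ω (X (n + 1) ω))
    · have := fStar_le_of_maximizer (f := f) hℓ hsel
        (v := fun k => ruleEst f h X ε D I k n ω (X (n + 1) ω)) (x := X (n + 1) ω) (η := η / 6)
        fun k => (hN n hNn k _ (hX _ hj)).le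
      rw [← hI] at this
      linarith
    · have h1 := Finset.single_le_sum hnn (Finset.mem_univ (I (n + 1) ω))
      rw [if_pos ⟨rfl, hbad n hMn hI⟩] at h1
      nlinarith
  have hcount := eventually_all.2 fun i => hfew (η / (3 * A' * ℓ)) (by positivity) i
  filter_upwards [hcount, eventually_ge_atTop J,
    (tendsto_natCast_atTop_atTop (R := ℝ)).eventually_ge_atTop (3 * A' * J / η)] with n hn hnJ hnA
  rw [div_le_iff₀ hη] at hnA
  refine (Finset.sum_le_sum fun j hj => hpoint j (Finset.mem_Ioc.1 hj).1).trans ?_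
  rw [Finset.sum_add_distrib, Finset.sum_add_distrib, ← Finset.mul_sum, ← Finset.mul_sum,
    Finset.sum_const, Nat.card_Ioc, nsmul_eq_mul, Nat.sub_zero, Finset.sum_comm]
  simp_rw [Finset.sum_boole]
  have h1 : (((Finset.Ioc 0 n).filter fun j => j ≤ J).card : ℝ) ≤ J := by
    have : (Finset.Ioc 0 n).filter (fun j => j ≤ J) ⊆ Finset.Ioc 0 J := fun j hj => by
      simp only [Finset.mem_filter, Finset.mem_Ioc] at hj ⊢
      exact ⟨hj.1.1, hj.2⟩
    exact_mod_cast (Finset.card_le_card this).trans_eq (by simp)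
  have h2 : ∑ i, (((Finset.Ioc 0 n).filter fun j => I j ω = i ∧ bad i j).card : ℝ) ≤
      ℓ * (η / (3 * A' * ℓ) * n) := by
    refine (Finset.sum_le_card_nsmul _ _ _ fun i _ => hn i).trans_eq ?_
    simp
  have h3 := mul_le_mul_of_nonneg_left h1 hA0.le
  have h4 := mul_le_mul_of_nonneg_left h2 hA0.le
  have h5 : A' * (ℓ * (η / (3 * A' * ℓ) * n)) = η / 3 * n := by field_simp
  linarith

end Consistency

/-! ### Law of large numbers for the optimal reward -/

section Probabilistic

variable {Ω : Type*} {ℓ d : ℕ} [mΩ : MeasurableSpace Ω] {μ : Measure Ω} {PX : Measure (Fin d → ℝ)}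
  {X : ℕ → Ω → Fin d → ℝ} {ε : ℕ → Ω → Fin ℓ → ℝ} {D : ℕ → Ω → ℝ≥0∞} {I : ℕ → Ω → Fin ℓ}
  {f : Fin ℓ → (Fin d → ℝ) → ℝ}

theorem ae_tendsto_mean_fStar (hmodel : IsModel μ PX X ε D I) (hf : MeanRewardCondition μ f X) :
    ∀ᵐ ω ∂μ, Tendsto (fun n : ℕ => (∑ j ∈ Finset.Ioc 0 n, fStar f (X j ω)) / n) atTop
      (𝓝 (∫ ω, fStar f (X 1 ω) ∂μ)) := by
  have hcube : MeasurableSet (unitCube d) := measurableSet_Icc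
  -- The f_i are controlled only on the cube; cutting them off outside makes the maximum measurable
  -- and changes nothing along the covariates.
  set φ : (Fin d → ℝ) → ℝ := fun x => ⨆ i, (unitCube d).indicator (f i) x with hφ
  have hφm : Measurable φ := by
    refine Measurable.iSup fun i => ?_
    classical
    rw [← Set.piecewise_eq_indicator]
    exact (hf.continuousOn i).measurable_piecewise continuousOn_const hcube
  have hφX : ∀ j, (fun ω => φ (X (j + 1) ω)) = fun ω => fStar f (X (j + 1) ω) := fun j => by
    ext ω
    simp only [hφ, fStar, Set.indicator_of_mem (hmodel.covariate_mem (j + 1) (by omega) ω)]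
  have hint : Integrable (fun ω => φ (X (0 + 1) ω)) μ := by
    rw [hφX 0]
    -- The Bochner integral of a non-integrable function is 0, so a positive mean already forces
    -- integrability.
    by_contra hni
    exact hf.mean_pos.ne' (integral_undef hni)
  have hXm : ∀ j, Measurable (X (j + 1)) := fun j => hmodel.measurable_covariate _ (by omega)
  have hident : ∀ j, IdentDistrib (X (j + 1)) (X (0 + 1)) μ μ := fun j =>
    ⟨(hXm j).aemeasurable, (hXm 0).aemeasurable, by
      rw [hmodel.covariate_law _ (by omega), hmodel.covariate_law _ (by omega)]⟩
  have hslln := strong_law_ae_real (fun j ω => φ (X (j + 1) ω)) hint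
    (fun i j hij => (hmodel.covariate_indep.indepFun hij).comp hφm hφm)
    fun j => (hident j).comp hφm
  filter_upwards [hslln] with ω hω
  rw [hφX 0] at hω
  refine hω.congr fun n => ?_
  have : ∀ j, φ (X (j + 1) ω) = fStar f (X (j + 1) ω) := fun j => congrFun (hφX j) ω
  simp_rw [this]
  rw [Finset.range_eq_Ico, Finset.sum_Ico_add' (fun j => fStar f (X j ω))]
  rfl

end Probabilistic

end DelayedBandit

open DelayedBandit in
theorem theorem2 {Ω : Type*} [MeasurableSpace Ω] (μ : Measure Ω) [IsProbabilityMeasure μ]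
    {ℓ d : ℕ} (hℓ : 2 ≤ ℓ) (hd : 1 ≤ d)
    (f : Fin ℓ → (Fin d → ℝ) → ℝ) (PX : Measure (Fin d → ℝ))
    (X : ℕ → Ω → Fin d → ℝ) (ε : ℕ → Ω → Fin ℓ → ℝ) (D : ℕ → Ω → ℝ≥0∞) (I : ℕ → Ω → Fin ℓ)
    (h prob : ℕ → ℝ) (a : ℕ → Fin ℓ) (sel : (Fin ℓ → ℝ) → Fin ℓ) (α β : ℝ)
    -- the bandwidths: `1 / h_n` is a positive integer and `h_n → 0`
    (hh : ∀ n, 1 ≤ n → ∃ K : ℕ, 0 < K ∧ h n = 1 / (K : ℝ))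
    (hh_lim : Tendsto h atTop (𝓝 0))
    -- the exploration probabilities: in `(0,1]`, decreasing to zero
    (hprob : ∀ n, 1 ≤ n → 0 < prob n ∧ prob n ≤ 1)
    (hprob_anti : ∀ m n, 1 ≤ m → m ≤ n → prob n ≤ prob m)
    (hprob_lim : Tendsto prob atTop (𝓝 0))
    -- the model and the allocation rule, whose initialization ends almost surely
    (hmodel : IsModel μ PX X ε D I)
    (hrule : FollowsRule μ f h prob a sel X ε D I)
    (hinit : ∀ᵐ ω ∂μ, ∃ n, InitDone D I n ω)
    -- the conditions on mean rewards, design, errors and delays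
    (hf : MeanRewardCondition μ f X)
    (hdesign : DesignCondition PX)
    (hbern : BernsteinCondition μ ε)
    (hαβ : 0 < α ∨ (α = 0 ∧ 1 < β))
    (hdelay : DelayCondition μ D α β)
    -- the condition on the bandwidths and exploration probabilities
    (hrate : Tendsto (fun n : ℕ => (n : ℝ) ^ α * Real.log n ^ (β - 1) * h n ^ d * prob n ^ 2)
      atTop atTop) :
    (∀ i, ∀ᵐ ω ∂μ, TendstoUniformlyOn (fun (n : ℕ) x => histEst f h X ε D I i n ω x) (f i)
      atTop (unitCube d)) ∧
    (∀ i, ∀ᵐ ω ∂μ, TendstoUniformlyOn (fun (n : ℕ) x => ruleEst f h X ε D I i n ω x) (f i)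
      atTop (unitCube d)) ∧
    StronglyConsistent μ f X I := by
  have hh' := pos_and_le_one_of_bandwidth hh
  obtain ⟨b, hb, hcard⟩ := ae_eventually_le_card_armTimes hh hprob hprob_anti hprob_lim hmodel
    hrule hinit hdesign hdelay hrate
  have hB := (tendsto_rate_atTop hh' hprob hrate).const_mul_atTop hb
  have hhist : ∀ i, ∀ᵐ ω ∂μ, TendstoUniformlyOn (fun (n : ℕ) x => histEst f h X ε D I i n ω x)
      (f i) atTop (unitCube d) := by
    intro i
    -- The tolerances 1/(k+1) form a countable family, so a single null set serves every δ.
    have herr := ae_all_iff.2 fun k : ℕ => ae_eventually_error_sum_le hh hprob hmodel hbern hrate hb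
      (Nat.one_div_pos_of_nat (α := ℝ) (n := k)) i
    filter_upwards [hcard i, herr] with ω hω herr
    refine tendstoUniformlyOn_histEst hh hh_lim (fun j hj => hmodel.covariate_mem j hj ω)
      (hf.continuousOn i) ?_ fun δ hδ => ?_
    · filter_upwards [hω, hB.eventually_gt_atTop 0] with n hn hn0 x hx
      exact_mod_cast hn0.trans_le (hn x hx)
    · obtain ⟨k, hk⟩ := exists_nat_one_div_lt hδ
      filter_upwards [hω, herr k] with n hn he x hx
      exact (he x hx (hn x hx)).trans (by gcongr)
  have hruleEst : ∀ i, ∀ᵐ ω ∂μ, TendstoUniformlyOn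
      (fun (n : ℕ) x => ruleEst f h X ε D I i n ω x) (f i) atTop (unitCube d) := by
    intro i
    filter_upwards [hcard i, hhist i] with ω hω hhω
    refine tendstoUniformlyOn_ruleEst hhω fun P =>
      -- Growth of the count in one cell suffices; the cell of the origin is taken.
      exists_newReward (x := 0) (X := X) (h := h) hB ?_ P
    filter_upwards [hω] with n hn
    exact hn 0 ⟨le_rfl, zero_le_one⟩
  refine ⟨hhist, hruleEst, ?_⟩
  obtain ⟨A, hA⟩ := hf.gap_bounded
  have hfew := ae_all_iff.2 fun k : ℕ => ae_all_iff.2 fun i =>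
    ae_eventually_improbable_pulls_le hprob hprob_lim hmodel
      (Nat.one_div_pos_of_nat (α := ℝ) (n := k)) i
  filter_upwards [ae_tendsto_mean_fStar hmodel hf, ae_all_iff.2 hruleEst, hfew,
    ae_armProb_le_of_ne hrule, hinit] with ω hmean hunif hfew hexpl ⟨M, hM⟩
  refine tendsto_rewardRatio hf.mean_pos hmean fun η hη => ?_
  refine eventually_regret_le (by omega) hrule.sel_max
    (fun j hj => hmodel.covariate_mem j hj ω) hA hunif
    (fun i j => armProb μ X ε D I i j ω ≤ prob j)
    (fun n hn => hexpl n (hM.mono hn)) (fun δ hδ i => ?_) hη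
  obtain ⟨k, hk⟩ := exists_nat_one_div_lt hδ
  filter_upwards [hfew k i] with n hn
  exact hn.trans (by gcongr)
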